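/- Let $B'\subset\mathbb{P}^5$ be the symmetric Burkhardt quartic threefold over $\mathbb{Q}$, defined by $\sigma_1=\sigma_4=0$, where $\sigma_1,\sigma_4$ are the elementary symmetric polynomials of degrees $1$ and $4$ in $x_1,\dots,x_6$. Let $\mathcal{C}\subset\mathbb{P}^2\times\mathbb{A}^2$ be the threefold over $\mathbb{Q}$ defined, in homogeneous coordinates $(X:Y:Z)$ on $\mathbb{P}^2$ and affine coordinates $(u,v)$ on $\mathbb{A}^2$, by \[\begin{split} C_{(u,v)}\colon\ & (u+v-1)XY(X+Y)+(-uv+u+v)(X^2+Y^2)Z\\ &+(-u^2-3uv+3u-v^2+3v-1)XYZ+(u^2v+uv^2-uv)Z^3\\ &+(u^2v-u^2+uv^2-3uv+u-v^2+v)(X+Y)Z^2=0. \end{split}\] Then: 1. $\mathcal{C}$ and $B'$ are geometrically irreducible, and the morphism $\mathcal{C}\to B'$ over $\mathbb{Q}$ given by \[(x_1:x_2:x_3:x_4:x_5:x_6)=(X:Y:-uZ:-vZ:Z:-X-Y+(u+v-1)Z)\] is birational over $\mathbb{Q}$. 2. $\mathcal{C}$ is an elliptic threefold over the $(u,v)$-plane: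 its generic fibre, the plane cubic $C_{(u,v)}$ over the field $\mathbb{Q}(u,v)$, is smooth, and it has the rational points $(1:0:0)$, $(0:1:0)$, $(1:-1:0)$ as flexes. More generally, for every field $L\supseteq\mathbb{Q}$ and all $u,v\in L$ such that the plane cubic $C_{(u,v)}$ is smooth, these three points are flexes of $C_{(u,v)}$. 3. The set $B'(\mathbb{Q})$ of rational points is Zariski-dense in $B'$. -/

import Mathlib

open scoped LinearAlgebra.Projectivization Topology

noncomputable section

/-! Classical varieties in products `ℙⁿ × 𝔸ᵐ`. Throughout, `k` is the field of definition and `K` is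
an (algebraically closed) extension field in which points have their coordinates. -/

/-- The `K`-points of `ℙⁿ × 𝔸ᵐ`. For `m = 0` this is projective space `ℙⁿ`. -/
abbrev ProjAff (K : Type*) [Field K] (n m : ℕ) : Type _ :=
  ℙ K (Fin (n + 1) → K) × (Fin m → K)

/-- Polynomials over `R` in the projective coordinates `x₀, …, xₙ`, whose coefficients are polynomials
in the affine coordinates `a₁, …, aₘ`. `MvPolynomial.IsHomogeneous` on this ring is homogeneity in the
projective coordinates. -/
abbrev ProjAffPoly (R : Type*) [CommRing R] (n m : ℕ) : Type _ :=
  MvPolynomial (Fin (n + 1)) (MvPolynomial (Fin m) R)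

section ClassicalVarieties

variable (k : Type*) {K : Type*} [Field k] [Field K] [Algebra k K]

variable {k} in
/-- The value of `F` at (the chosen representative of) a point of `ℙⁿ × 𝔸ᵐ`. For `F` homogeneous,
its vanishing, and quotients of two such values of the same degree, do not depend on the
representative. -/
def valueAt {n m : ℕ} (F : ProjAffPoly k n m) (p : ProjAff K n m) : K :=
  MvPolynomial.eval₂ (MvPolynomial.aeval p.2 : MvPolynomial (Fin m) k →ₐ[k] K).toRingHom p.1.rep F

variable (K) in
/-- The Zariski topology over `k` on `ℙⁿ × 𝔸ᵐ`: it is generated by the principal open sets `F ≠ 0`,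
where `F` has coefficients in `k` and is homogeneous in the projective coordinates. For `k = K` this
is the usual Zariski topology; for general `k` its open sets are the open sets defined over `k`. -/
@[reducible] def zariski (n m : ℕ) : TopologicalSpace (ProjAff K n m) :=
  TopologicalSpace.generateFrom
    {U | ∃ (d : ℕ) (F : ProjAffPoly k n m), F.IsHomogeneous d ∧ U = {p | valueAt F p ≠ 0}}

/-- `f` is a regular map over `k` on `U`: around each point of `U` the projective coordinates of
`f` are given by polynomials over `k` that are homogeneous of the same degree, and the affine
coordinates of `f` by quotients of polynomials over `k` that are homogeneous of the same degree. -/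
def IsRegularOver {n m n' m' : ℕ} (U : Set (ProjAff K n m))
    (f : ProjAff K n m → ProjAff K n' m') : Prop :=
  ∀ p ∈ U, ∃ (d e : ℕ) (P : Fin (n' + 1) → ProjAffPoly k n m) (N : Fin m' → ProjAffPoly k n m)
    (D : ProjAffPoly k n m),
    (∀ i, (P i).IsHomogeneous d) ∧ (∀ j, (N j).IsHomogeneous e) ∧ D.IsHomogeneous e ∧
    valueAt D p ≠ 0 ∧ (fun i => valueAt (P i) p) ≠ 0 ∧
    ∀ q ∈ U, valueAt D q ≠ 0 → ∀ h : (fun i => valueAt (P i) q) ≠ 0,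
      (f q).1 = Projectivization.mk K (fun i => valueAt (P i) q) h ∧
      ∀ j, (f q).2 j = valueAt (N j) q / valueAt D q

/-- `f` is a birational morphism over `k` between the (geometrically) irreducible varieties `X` and
`Y`: it is regular over `k` on all of `X`, maps `X` to `Y`, and restricts to an isomorphism over `k`
between dense open subsets `X ∩ U` and `Y ∩ V` defined over `k`. -/
structure IsBirationalMorphism {n m n' m' : ℕ} (X : Set (ProjAff K n m)) (Y : Set (ProjAff K n' m'))
    (f : ProjAff K n m → ProjAff K n' m') : Prop where
  irreducible_source : @IsIrreducible _ (zariski K K n m) X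
  irreducible_target : @IsIrreducible _ (zariski K K n' m') Y
  regular : IsRegularOver k X f
  mapsTo : Set.MapsTo f X Y
  exists_inverse : ∃ (U : Set (ProjAff K n m)) (V : Set (ProjAff K n' m'))
    (g : ProjAff K n' m' → ProjAff K n m),
    IsOpen[zariski k K n m] U ∧ X ⊆ closure[zariski K K n m] (X ∩ U) ∧
    IsOpen[zariski k K n' m'] V ∧ Y ⊆ closure[zariski K K n' m'] (Y ∩ V) ∧
    IsRegularOver k (Y ∩ V) g ∧
    Set.MapsTo f (X ∩ U) (Y ∩ V) ∧ Set.MapsTo g (Y ∩ V) (X ∩ U) ∧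
    Set.InvOn g f (X ∩ U) (Y ∩ V)

variable (K) in
/-- The `k`-rational points of `ℙⁿ × 𝔸ᵐ`, inside its `K`-points. -/
def rationalPoints (n m : ℕ) : Set (ProjAff K n m) :=
  {p | ∃ (x : Fin (n + 1) → k) (a : Fin m → k) (h : (fun i => algebraMap k K (x i)) ≠ 0),
    p = (Projectivization.mk K (fun i => algebraMap k K (x i)) h, fun j => algebraMap k K (a j))}

end ClassicalVarieties

section PlaneCurves

variable {L : Type*} [Field L]

/-- The plane curve `F = 0` (`F` homogeneous in three variables) is smooth: it has no singular
point over the algebraic closure. -/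
def IsSmoothPlaneCurve (F : MvPolynomial (Fin 3) L) : Prop :=
  ∀ x : Fin 3 → AlgebraicClosure L, x ≠ 0 → MvPolynomial.aeval x F = 0 →
    ∃ i, MvPolynomial.aeval x (MvPolynomial.pderiv i F) ≠ 0

/-- The `L`-rational point `(x₀ : x₁ : x₂)` is a flex of the plane curve `F = 0`: it is a smooth
point of the curve, and some line (necessarily the tangent line) through it, not contained in the
curve, meets the curve there with multiplicity at least three. The line is given by a second
point `y`, and `F` is restricted to the points `x + T y`. -/
def IsFlex (F : MvPolynomial (Fin 3) L) (x : Fin 3 → L) : Prop :=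
  MvPolynomial.eval x F = 0 ∧ (∃ i, MvPolynomial.eval x (MvPolynomial.pderiv i F) ≠ 0) ∧
  ∃ y : Fin 3 → L, LinearIndependent L ![x, y] ∧
    3 ≤ Polynomial.rootMultiplicity 0
      (MvPolynomial.aeval (fun i => Polynomial.C (x i) + Polynomial.X * Polynomial.C (y i)) F :
        Polynomial L)

end PlaneCurves

section Burkhardt

/-- The cubic form defining `C_{(u,v)}`, in the variables `X = X 0`, `Y = X 1`, `Z = X 2`, with
parameters `u`, `v` in any commutative ring. -/
def cubicForm {R : Type*} [CommRing R] (u v : R) : MvPolynomial (Fin 3) R :=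
  let X : MvPolynomial (Fin 3) R := MvPolynomial.X 0
  let Y : MvPolynomial (Fin 3) R := MvPolynomial.X 1
  let Z : MvPolynomial (Fin 3) R := MvPolynomial.X 2
  let c : R → MvPolynomial (Fin 3) R := fun r => MvPolynomial.C r
  c (u + v - 1) * (X * Y * (X + Y))
    + c (-(u * v) + u + v) * ((X ^ 2 + Y ^ 2) * Z)
    + c (-u ^ 2 - 3 * u * v + 3 * u - v ^ 2 + 3 * v - 1) * (X * Y * Z)
    + c (u ^ 2 * v + u * v ^ 2 - u * v) * Z ^ 3
    + c (u ^ 2 * v - u ^ 2 + u * v ^ 2 - 3 * u * v + u - v ^ 2 + v) * ((X + Y) * Z ^ 2)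

variable (K : Type*) [Field K]

/-- The threefold in `ℙ² × 𝔸²` defined by the cubic form with parameters the affine coordinates
`(u, v)`. -/
def cubicThreefold [Algebra ℚ K] : Set (ProjAff K 2 2) :=
  {p | valueAt (cubicForm (MvPolynomial.X 0) (MvPolynomial.X 1) : ProjAffPoly ℚ 2 2) p = 0}

/-- The symmetric Burkhardt quartic `σ₁ = σ₄ = 0` in `ℙ⁵`. -/
def symmetricBurkhardt [Algebra ℚ K] : Set (ProjAff K 5 0) :=
  {p | valueAt (MvPolynomial.esymm (Fin 6) (MvPolynomial (Fin 0) ℚ) 1 : ProjAffPoly ℚ 5 0) p = 0 ∧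
    valueAt (MvPolynomial.esymm (Fin 6) (MvPolynomial (Fin 0) ℚ) 4 : ProjAffPoly ℚ 5 0) p = 0}

variable {K}

/-- The linear map `(X, Y, Z) ↦ (X, Y, -uZ, -vZ, Z, -X - Y + (u + v - 1)Z)`. -/
def planeEmbedding (u v : K) : (Fin 3 → K) →ₗ[K] (Fin 6 → K) where
  toFun x := ![x 0, x 1, -u * x 2, -v * x 2, x 2, -x 0 - x 1 + (u + v - 1) * x 2]
  map_add' x y := by
    ext i
    fin_cases i <;> simp <;> ring
  map_smul' c x := by
    ext i
    fin_cases i <;> simp <;> ring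

theorem planeEmbedding_injective (u v : K) : Function.Injective (planeEmbedding u v) := by
  intro x y h
  have h0 := congrFun h 0
  have h1 := congrFun h 1
  have h4 := congrFun h 4
  simp [planeEmbedding] at h0 h1 h4
  ext i
  fin_cases i <;> simp [h0, h1, h4]

/-- The map `((X : Y : Z), (u, v)) ↦ (X : Y : -uZ : -vZ : Z : -X - Y + (u + v - 1)Z)`. -/
def mapToBurkhardt (p : ProjAff K 2 2) : ProjAff K 5 0 :=
  (Projectivization.map (planeEmbedding (p.2 0) (p.2 1)) (planeEmbedding_injective _ _) p.1, ![])

end Burkhardt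

end

/-! Write `y = (x₃, …, x₆)` and `w = x₁ - x₂`, and let `eᵢ` be the elementary symmetric functions of
`y`. On `σ₁ = 0` one has `4σ₄ = Q(y) - e₂w²` with `Q = e₁²e₂ - 4e₁e₃ + 4e₄`, so `B'` is the double
cover `e₂w² = Q`. Irreducibility and density come from one statement, `exists_rational_point`: two
polynomials in `(y, w)`, neither divisible by `e₂w² - Q`, are both nonzero at some rational point of
the cover. Since `e₂` is prime and does not divide `Q`, taking norms to the `y`-space reduces this
to finding rational points of the cover whose images are Zariski-dense there. Those points have
coordinates `y` that are odd 2-adically. If three coordinates are fixed, `m = e₂` is an affine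
function of the fourth and `Q` is a cubic in it, so `v² = mQ` is a cubic curve in the coordinate
`1/m`, with origin `m = 0`. Duplication multiplies `m` by 4 times a 2-adic unit. Hence its iterates
never repeat, and every odd point has infinitely many odd neighbours in each coordinate direction
(`IsOddPoint.infinite_update`). A polynomial vanishing at all of them is zero. Along the given map,
`σ₄` pulls back to `Z` times the cubic form. So the map is an isomorphism from `Z ≠ 0` to `x₅ ≠ 0`,
and irreducibility of the cubic threefold follows from the same statement once powers of `Z` are
cleared. With `a = u + v - 1`, the identity `a²F = pqr + cZ³`, where `p`, `q`, `r` are linear forms,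
shows the flexes and their tangents, and gives the discriminant (`sq_mul_cubicValue`). -/

noncomputable section

/-! ### Symmetric functions, the branch quartic and the duplication formula. -/

section SymmetricFunctions

variable {R : Type*} [CommRing R]

/-- The first elementary symmetric function of four elements. -/
def symOne (y : Fin 4 → R) : R := y 0 + y 1 + y 2 + y 3

/-- The second elementary symmetric function of four elements. -/
def symTwo (y : Fin 4 → R) : R :=
  y 0 * y 1 + y 0 * y 2 + y 0 * y 3 + y 1 * y 2 + y 1 * y 3 + y 2 * y 3

/-- The third elementary symmetric function of four elements. -/
def symThree (y : Fin 4 → R) : R :=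
  y 0 * y 1 * y 2 + y 0 * y 1 * y 3 + y 0 * y 2 * y 3 + y 1 * y 2 * y 3

/-- The quartic form `e₁²e₂ - 4e₁e₃ + 4e₄`. The symmetric Burkhardt quartic is the double cover
`e₂w² = e₁²e₂ - 4e₁e₃ + 4e₄` of `ℙ³`. -/
def branchQuartic (y : Fin 4 → R) : R :=
  symOne y ^ 2 * symTwo y - 4 * symOne y * symThree y + 4 * (y 0 * y 1 * y 2 * y 3)

theorem symTwo_map {S : Type*} [CommRing S] (f : R →+* S) (y : Fin 4 → R) :
    f (symTwo y) = symTwo (fun i => f (y i)) := by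
  simp [symTwo]

theorem branchQuartic_map {S : Type*} [CommRing S] (f : R →+* S) (y : Fin 4 → R) :
    f (branchQuartic y) = branchQuartic (fun i => f (y i)) := by
  simp [branchQuartic, symOne, symTwo, symThree, map_ofNat f 4]

/-- Duplication on `Y² = c₃x³ + c₂x² + c₁x + c₀` in the coordinate `m = 1/x`, with `d = 4c₀`. -/
theorem duplication_identity (c₃ c₂ c₁ d m : R) :
    let q := 4 * c₃ + 4 * c₂ * m + 4 * c₁ * m ^ 2 + d * m ^ 3
    let D := c₃ ^ 2 - 2 * c₁ * c₃ * m ^ 2 - 2 * d * c₃ * m ^ 3 + (c₁ ^ 2 - d * c₂) * m ^ 4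
    let G := 3 * c₃ + 2 * c₂ * m + c₁ * m ^ 2
    4 * D ^ 3 + 4 * c₂ * m * q * D ^ 2 + 4 * c₁ * c₃ * m ^ 2 * q ^ 2 * D
      + d * c₃ ^ 2 * m ^ 3 * q ^ 3 = (c₃ * q ^ 2 + 2 * G * (G ^ 2 - q * (c₂ * m + 3 * c₃))) ^ 2 := by
  intro q D G
  simp only [q, D, G]
  ring

end SymmetricFunctions

/-! ### The localization of the integers at 2. -/

/-- The rational numbers with odd denominator. -/
def oddDenominators : Subring ℚ where
  carrier := {q | padicNorm 2 q ≤ 1}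
  mul_mem' {a b} ha hb := by
    simp only [Set.mem_ofPred_eq, padicNorm.mul] at *
    exact mul_le_one₀ ha (padicNorm.nonneg _) hb
  one_mem' := by simp
  add_mem' {a b} ha hb := (padicNorm.nonarchimedean (p := 2)).trans (max_le ha hb)
  zero_mem' := by simp
  neg_mem' {a} ha := by simpa using ha

namespace oddDenominators

/-- The ring is local with maximal ideal `(2)`: an element `2b + 1` has 2-adic norm 1, and so does
its inverse. -/
theorem isUnit_of_odd {x : oddDenominators} (hx : Odd x) : IsUnit x := by
  obtain ⟨b, rfl⟩ := hx
  have hb : padicNorm 2 (2 * (b : ℚ)) < 1 := by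
    rw [padicNorm.mul, show padicNorm 2 (2 : ℚ) = 2⁻¹ by
      simpa using padicNorm.padicNorm_p_of_prime (p := 2)]
    have h1 : padicNorm 2 (b : ℚ) ≤ 1 := b.2
    linarith
  have h1 : padicNorm 2 (2 * (b : ℚ) + 1) = 1 := by
    rw [padicNorm.add_eq_max_of_ne (by rw [padicNorm.one]; exact hb.ne), padicNorm.one,
      max_eq_right hb.le]
  have h0 : (2 * (b : ℚ) + 1) ≠ 0 := by
    intro h
    simp [h] at h1
  refine IsUnit.of_mul_eq_one ⟨(2 * (b : ℚ) + 1)⁻¹, ?_⟩ (Subtype.ext ?_)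
  · change padicNorm 2 _ ≤ 1
    have h2 := padicNorm.mul (p := 2) (2 * (b : ℚ) + 1) (2 * (b : ℚ) + 1)⁻¹
    rw [mul_inv_cancel₀ h0, padicNorm.one, h1, one_mul] at h2
    exact h2.symm.le
  · exact mul_inv_cancel₀ h0

theorem ne_zero_of_odd {x : oddDenominators} (hx : Odd x) : x ≠ 0 := (isUnit_of_odd hx).ne_zero

theorem exists_not_two_pow_dvd {x : oddDenominators} (hx : x ≠ 0) :
    ∃ n : ℕ, ¬ (2 : oddDenominators) ^ n ∣ x := by
  by_contra! h
  have hx' : (x : ℚ) ≠ 0 := by simpa using hx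
  have hpos : 0 < padicNorm 2 (x : ℚ) := by
    have := padicNorm.nonzero (p := 2) hx'
    exact lt_of_le_of_ne (padicNorm.nonneg _) this.symm
  obtain ⟨n, hn⟩ := exists_pow_lt_of_lt_one hpos (by norm_num : (2⁻¹ : ℚ) < 1)
  obtain ⟨c, hc⟩ := h n
  have h2 : padicNorm 2 (x : ℚ) = 2⁻¹ ^ n * padicNorm 2 (c : ℚ) := by
    rw [hc]
    have h5 : ∀ n : ℕ, padicNorm 2 ((2 : ℚ) ^ n) = 2⁻¹ ^ n := by
      intro n
      induction n with
      | zero => simp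
      | succ n ih =>
        rw [pow_succ, padicNorm.mul, ih, pow_succ, show padicNorm 2 (2 : ℚ) = 2⁻¹ by
          simpa using padicNorm.padicNorm_p_of_prime (p := 2)]
    rw [← h5, ← padicNorm.mul]
    rfl
  have h3 : padicNorm 2 (c : ℚ) ≤ 1 := c.2
  have h4 : (0 : ℚ) < 2⁻¹ ^ n := by positivity
  nlinarith

end oddDenominators

open oddDenominators

/-! ### Odd points and duplication on the fibres. -/

/-- Points of the double cover with odd coordinates; these are close to a node `2`-adically. -/
def IsOddPoint (y : Fin 4 → oddDenominators) : Prop :=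
  (∀ i, Odd (y i)) ∧ symTwo y ≠ 0 ∧
    IsSquare ((symTwo y * branchQuartic y : oddDenominators) : ℚ)

/-- On the fibre with `a, b, c` fixed, `m = e₂` serves as coordinate in place of `t`, because `e₂ =
s₁t + s₂` with `s₁` a unit. Doubling the given point multiplies `m` by `4c₃r/D`, where `c₃`, `r`,
`D` are odd; one of the two factors 2 gained suffices. -/
theorem IsOddPoint.exists_duplication_aux {a b c t : oddDenominators} (h : IsOddPoint ![a, b, c, t])
    {n : ℕ} (hn : 2 ^ n ∣ symTwo ![a, b, c, t]) :
    ∃ t', IsOddPoint ![a, b, c, t'] ∧ 2 ^ (n + 1) ∣ symTwo ![a, b, c, t'] := by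
  obtain ⟨hodd, hne, hsq⟩ := h
  have ha : Odd a := hodd 0
  have hb : Odd b := hodd 1
  have hc : Odd c := hodd 2
  have ht : Odd t := hodd 3
  obtain ⟨s₁, hs₁⟩ : ∃ s, s = a + b + c := ⟨_, rfl⟩
  obtain ⟨s₂, hs₂⟩ : ∃ s, s = a * b + a * c + b * c := ⟨_, rfl⟩
  obtain ⟨s₃, hs₃⟩ : ∃ s, s = a * b * c := ⟨_, rfl⟩
  have o₁ : Odd s₁ := hs₁ ▸ (ha.add_odd hb).add_odd hc
  have o₂ : Odd s₂ := hs₂ ▸ ((ha.mul hb).add_odd (ha.mul hc)).add_odd (hb.mul hc)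
  have o₃ : Odd s₃ := hs₃ ▸ (ha.mul hb).mul hc
  obtain ⟨i, hi⟩ := (isUnit_of_odd o₁).exists_right_inv
  have oi : Odd i := by
    obtain ⟨p, hp⟩ := o₁
    refine ⟨-p * i, ?_⟩
    rw [hp] at hi
    linear_combination hi
  -- Since `e₁ = i(2k + m)`, this parity makes the coefficients of `m` and `m²` in the branch
  -- quartic divisible by 4.
  obtain ⟨k, hk⟩ : Even (s₁ ^ 2 - s₂) := by
    rw [sub_eq_add_neg]; exact o₁.pow.add_odd o₂.neg
  obtain ⟨c₃, hc₃⟩ : ∃ z, z = -(s₁ * s₃) + s₂ ^ 2 - s₂ ^ 3 * i ^ 2 := ⟨_, rfl⟩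
  obtain ⟨c₂, hc₂⟩ : ∃ z, z = (k * i) ^ 2 - s₂ + 2 * s₂ ^ 2 * i ^ 2 := ⟨_, rfl⟩
  obtain ⟨c₁, hc₁⟩ : ∃ z, z = k * i ^ 2 - s₂ * i ^ 2 := ⟨_, rfl⟩
  obtain ⟨d, hd⟩ : ∃ z, z = i ^ 2 := ⟨_, rfl⟩
  have oc₃ : Odd c₃ := by
    rw [hc₃, sub_eq_add_neg]
    exact ((o₁.mul o₃).neg.add_odd o₂.pow).add_odd (o₂.pow.mul oi.pow).neg
  have key : ∀ x t, s₁ * t = x - s₂ → symTwo ![a, b, c, t] = x ∧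
      branchQuartic ![a, b, c, t] = 4 * c₃ + 4 * c₂ * x + 4 * c₁ * x ^ 2 + d * x ^ 3 := by
    intro x t hx
    have h2 : symTwo ![a, b, c, t] = x := by
      simp only [symTwo, Matrix.cons_val]
      linear_combination hx - hs₂ - t * hs₁
    refine ⟨h2, ?_⟩
    have hit : t = i * (x - s₂) := by linear_combination i * hx - t * hi
    have he : s₁ + t = i * (2 * k + x) := by
      linear_combination hit - s₁ * hi + i * hk
    rw [branchQuartic, h2]
    have h3 : symOne ![a, b, c, t] = s₁ + t := by
      simp only [symOne, Matrix.cons_val]; rw [hs₁]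
    have h4 : symThree ![a, b, c, t] = s₃ + s₂ * t := by
      simp only [symThree, Matrix.cons_val]; rw [hs₂, hs₃]; ring
    rw [h3, h4]
    simp only [Matrix.cons_val]
    have h5 : -4 * (s₁ + t) * (s₃ + s₂ * t) + 4 * (s₃ * t)
        = 4 * (-(s₁ * s₃) - s₂ * (s₁ * t) - s₂ * t ^ 2) := by ring
    rw [hx] at h5
    rw [← hs₃, hc₃, hc₂, hc₁, hd]
    rw [he] at h5 ⊢
    linear_combination h5 - 4 * s₂ * (t + i * (x - s₂)) * hit
  obtain ⟨m, hm⟩ : ∃ m, m = symTwo ![a, b, c, t] := ⟨_, rfl⟩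
  have hmt : s₁ * t = m - s₂ := by
    rw [hm, hs₁, hs₂]; simp only [symTwo, Matrix.cons_val]; ring
  rw [(key m t hmt).1, (key m t hmt).2] at hsq
  rw [← hm] at hn hne
  obtain ⟨μ, hμ⟩ : Even m := by
    rw [show m = s₁ * t + s₂ by linear_combination -hmt]
    exact (o₁.mul ht).add_odd o₂
  obtain ⟨r, hr⟩ : ∃ r, r = c₃ + 2 * (c₂ * μ + 2 * c₁ * μ ^ 2 + d * μ ^ 3) := ⟨_, rfl⟩
  have or : Odd r := hr ▸ oc₃.add_even (even_two_mul _)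
  obtain ⟨q, hq⟩ : ∃ q, q = 4 * c₃ + 4 * c₂ * m + 4 * c₁ * m ^ 2 + d * m ^ 3 := ⟨_, rfl⟩
  have hqr : q = 4 * r := by rw [hq, hr, hμ]; ring
  obtain ⟨D, hD⟩ : ∃ D, D = c₃ ^ 2 - 2 * c₁ * c₃ * m ^ 2 - 2 * d * c₃ * m ^ 3
    + (c₁ ^ 2 - d * c₂) * m ^ 4 := ⟨_, rfl⟩
  have oD : Odd D := by
    rw [show D = c₃ ^ 2 + 2 * (-c₁ * c₃ * m ^ 2 - d * c₃ * m ^ 3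
      + 8 * (c₁ ^ 2 - d * c₂) * μ ^ 4) by rw [hD, hμ]; ring]
    exact oc₃.pow.add_even (even_two_mul _)
  obtain ⟨j, hj⟩ := (isUnit_of_odd oD).exists_right_inv
  -- The duplication formula in the coordinate `1/x`: `m' = c₃mq/D`.
  obtain ⟨m', hm'⟩ : ∃ m', m' = c₃ * m * q * j := ⟨_, rfl⟩
  have hm'2 : m' = 2 ^ 2 * m * (c₃ * r * j) := by rw [hm', hqr]; ring
  have em' : Even m' := by
    rw [hm'2, show (2 : oddDenominators) ^ 2 * m * (c₃ * r * j) = 2 * (2 * m * (c₃ * r * j)) by ring]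
    exact even_two_mul _
  have ot' : Odd (i * (m' - s₂)) := oi.mul (em'.sub_odd o₂)
  have hmt' : s₁ * (i * (m' - s₂)) = m' - s₂ := by linear_combination (m' - s₂) * hi
  refine ⟨i * (m' - s₂), ⟨?_, ?_, ?_⟩, ?_⟩
  · intro l
    fin_cases l
    exacts [ha, hb, hc, ot']
  · have h2 : (2 : oddDenominators) ≠ 0 := two_ne_zero
    rw [(key _ _ hmt').1, hm'2]
    have hj0 : j ≠ 0 := by rintro rfl; simp at hj
    exact mul_ne_zero (mul_ne_zero (pow_ne_zero _ h2) hne)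
      (mul_ne_zero (mul_ne_zero (ne_zero_of_odd oc₃) (ne_zero_of_odd or)) hj0)
  · rw [(key _ _ hmt').1, (key _ _ hmt').2]
    obtain ⟨v, hv⟩ := hsq
    obtain ⟨G, hG⟩ : ∃ G, G = 3 * c₃ + 2 * c₂ * m + c₁ * m ^ 2 := ⟨_, rfl⟩
    obtain ⟨S, hS⟩ : ∃ S, S = c₃ * q ^ 2 + 2 * G * (G ^ 2 - q * (c₂ * m + 3 * c₃)) := ⟨_, rfl⟩
    have hid := duplication_identity c₃ c₂ c₁ d m
    simp only [← hq, ← hD, ← hG, ← hS] at hid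
    -- By `duplication_identity`, `m'Q(m')` is `mQ(m)` times the square of `c₃S/D²`.
    refine ⟨(c₃ * S * j ^ 2 : oddDenominators) * v, ?_⟩
    have h6 : m' * (4 * c₃ + 4 * c₂ * m' + 4 * c₁ * m' ^ 2 + d * m' ^ 3)
        = (c₃ * S * j ^ 2) ^ 2 * (m * q) := by
      have h7 : (c₃ * S * j ^ 2) ^ 2 * (m * q) = c₃ ^ 2 * m * q * j ^ 4 * S ^ 2 := by ring
      have e₁ : D * j ^ 3 = j ^ 2 := by linear_combination j ^ 2 * hj
      have e₂ : D ^ 2 * j ^ 3 = j := by linear_combination D * j ^ 2 * hj + j * hj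
      have e₃ : D ^ 3 * j ^ 3 = 1 := by linear_combination (D ^ 2 * j ^ 2 + D * j + 1) * hj
      rw [h7, ← hid, hm']
      linear_combination -c₃ ^ 2 * m * q * j * (4 * e₃ + 4 * c₂ * m * q * e₂
        + 4 * c₁ * c₃ * m ^ 2 * q ^ 2 * e₁)
    rw [h6, Subring.coe_mul, hq, hv]
    push_cast
    ring
  · rw [(key _ _ hmt').1, hm'2]
    obtain ⟨z, hz⟩ := hn
    exact ⟨2 * z * (c₃ * r * j), by rw [hz]; ring⟩

/-- All the data are symmetric in the four coordinates, so the varying one may be moved to the last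
place. -/
theorem symTwo_update (y : Fin 4 → oddDenominators) (i : Fin 4) :
    ∃ a b c : oddDenominators, ∀ t, (IsOddPoint (Function.update y i t) ↔ IsOddPoint ![a, b, c, t]) ∧
      symTwo (Function.update y i t) = symTwo ![a, b, c, t] := by
  have main : ∀ (y' : Fin 4 → oddDenominators) (a b c t), symTwo y' = symTwo ![a, b, c, t] →
      branchQuartic y' = branchQuartic ![a, b, c, t] →
      ((∀ j, Odd (y' j)) ↔ Odd a ∧ Odd b ∧ Odd c ∧ Odd t) →
      (IsOddPoint y' ↔ IsOddPoint ![a, b, c, t]) ∧ symTwo y' = symTwo ![a, b, c, t] := by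
    intro y' a b c t h1 h2 h3
    refine ⟨?_, h1⟩
    rw [IsOddPoint, IsOddPoint, h1, h2, h3]
    simp [Fin.forall_fin_succ]
  fin_cases i
  · refine ⟨y 1, y 2, y 3, fun t => main _ _ _ _ _ ?_ ?_ ?_⟩
    · simp [symTwo]; ring
    · simp [branchQuartic, symOne, symTwo, symThree]; ring
    · simp [Fin.forall_fin_succ]; tauto
  · refine ⟨y 0, y 2, y 3, fun t => main _ _ _ _ _ ?_ ?_ ?_⟩
    · simp [symTwo]; ring
    · simp [branchQuartic, symOne, symTwo, symThree]; ring
    · simp [Fin.forall_fin_succ]; tauto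
  · refine ⟨y 0, y 1, y 3, fun t => main _ _ _ _ _ ?_ ?_ ?_⟩
    · simp [symTwo]; ring
    · simp [branchQuartic, symOne, symTwo, symThree]; ring
    · simp [Fin.forall_fin_succ]; tauto
  · refine ⟨y 0, y 1, y 2, fun t => main _ _ _ _ _ ?_ ?_ ?_⟩
    · simp [symTwo]
    · simp [branchQuartic, symOne, symTwo, symThree]
    · simp [Fin.forall_fin_succ]

/-- Duplication on the elliptic fibre on which all coordinates but the `i`-th are fixed. -/
theorem IsOddPoint.exists_duplication {y : Fin 4 → oddDenominators} (h : IsOddPoint y) (i : Fin 4)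
    {n : ℕ} (hn : 2 ^ n ∣ symTwo y) :
    ∃ t, IsOddPoint (Function.update y i t) ∧ 2 ^ (n + 1) ∣ symTwo (Function.update y i t) := by
  obtain ⟨a, b, c, habc⟩ := symTwo_update y i
  have h0 := habc (y i)
  rw [Function.update_eq_self] at h0
  obtain ⟨t, ht⟩ := IsOddPoint.exists_duplication_aux (h0.1.1 h) (h0.2 ▸ hn)
  exact ⟨t, (habc t).1.2 ht.1, (habc t).2 ▸ ht.2⟩

theorem IsOddPoint.exists_two_pow_dvd {y : Fin 4 → oddDenominators} (h : IsOddPoint y) (i : Fin 4)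
    (n : ℕ) :
    ∃ t, IsOddPoint (Function.update y i t) ∧ 2 ^ n ∣ symTwo (Function.update y i t) := by
  induction n with
  | zero => exact ⟨y i, by simpa using h, by simp⟩
  | succ n ih =>
    obtain ⟨t, ht, hn⟩ := ih
    obtain ⟨t', ht', hn'⟩ := ht.exists_duplication i hn
    rw [Function.update_idem] at ht' hn'
    exact ⟨t', ht', hn'⟩

/-- Each odd point has `e₂ ≠ 0`, hence finite 2-adic valuation of `e₂`. Finitely many points would
bound these valuations, whereas repeated duplication makes them arbitrarily large. -/
theorem IsOddPoint.infinite_update {y : Fin 4 → oddDenominators} (h : IsOddPoint y) (i : Fin 4) :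
    {t | IsOddPoint (Function.update y i t)}.Infinite := by
  intro hfin
  have hN : ∀ t, ∃ n : ℕ, IsOddPoint (Function.update y i t) →
      ¬ 2 ^ n ∣ symTwo (Function.update y i t) := by
    intro t
    by_cases ht : IsOddPoint (Function.update y i t)
    · exact (exists_not_two_pow_dvd ht.2.1).imp fun n hn _ => hn
    · exact ⟨0, fun h => absurd h ht⟩
  choose N hN using hN
  obtain ⟨M, hM⟩ := (hfin.image N).bddAbove
  obtain ⟨t, ht, hd⟩ := h.exists_two_pow_dvd i M
  exact hN t ht ((pow_dvd_pow 2 (hM ⟨t, ht, rfl⟩)).trans hd)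

theorem exists_isOddPoint : ∃ y, IsOddPoint y := by
  -- Here `e₂ = -84` and `Q = -756`, with product `252²`.
  refine ⟨![-11, -1, 5, 5], ?_, ?_, ?_⟩
  · intro i
    fin_cases i
    · exact ⟨-6, by norm_num⟩
    · exact ⟨-1, by norm_num⟩
    · exact ⟨2, by norm_num⟩
    · exact ⟨2, by norm_num⟩
  · simp [symTwo]
    norm_num
  · refine ⟨252, ?_⟩
    simp only [branchQuartic, symOne, symTwo, symThree, Matrix.cons_val]
    push_cast
    rw [show ((11 : oddDenominators) : ℚ) = 11 from rfl, show ((5 : oddDenominators) : ℚ) = 5 from rfl,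
      show ((4 : oddDenominators) : ℚ) = 4 from rfl]
    norm_num

/-! ### Zariski density of the odd points in affine 4-space. -/

/-- A polynomial vanishes if it does so on a nonempty set that contains, with each of its points,
infinitely many points that differ from it in the `i`-th coordinate only, for every `i`. -/
theorem eq_zero_of_infinite_update {σ K : Type*} [Finite σ] [DecidableEq σ] [Field K]
    [Infinite K] {S : Set (σ → K)} (hS : S.Nonempty)
    (hinf : ∀ y ∈ S, ∀ i, {t | Function.update y i t ∈ S}.Infinite) {p : MvPolynomial σ K}
    (hp : ∀ y ∈ S, MvPolynomial.eval y p = 0) : p = 0 := by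
  -- The set `I` consists of the coordinates already freed from `S`. Freeing all of them gives
  -- vanishing everywhere.
  have key : ∀ (I : Finset σ) (y z : σ → K), y ∈ S → (∀ i ∉ I, z i = y i) →
      MvPolynomial.eval z p = 0 := by
    intro I
    induction I using Finset.induction_on with
    | empty =>
      intro y z hy hz
      rw [show z = y from funext fun i => hz i (by simp)]
      exact hp y hy
    | insert i I hi ih =>
      intro y z hy hz
      let f : Polynomial K := MvPolynomial.aeval
        (Function.update (fun j => Polynomial.C (z j)) i Polynomial.X) p
      have hf : ∀ t, f.eval t = MvPolynomial.eval (Function.update z i t) p := by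
        intro t
        have : (Polynomial.evalRingHom t).comp (MvPolynomial.aeval (R := K)
            (Function.update (fun j => Polynomial.C (z j)) i Polynomial.X)).toRingHom
            = MvPolynomial.eval (Function.update z i t) := by
          apply MvPolynomial.ringHom_ext
          · intro r
            simp
          · intro j
            by_cases hj : j = i
            · subst hj; simp
            · simp [hj]
        exact congrArg (fun g => g p) this
      -- The roots `t` come from moving `y` within `S` in direction `i`. The moved point agrees with
      -- `update z i t` outside `I`, so the induction hypothesis applies.
      have h0 : f = 0 := by
        refine Polynomial.eq_zero_of_infinite_isRoot f ((hinf y hy i).mono fun t ht => ?_)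
        change f.eval t = 0
        rw [hf]
        refine ih _ _ ht fun j hj => ?_
        by_cases hji : j = i
        · subst hji; simp
        · simpa [hji] using hz j (by simp [hji, hj])
      simpa [h0] using (hf (z i)).symm
  obtain ⟨y, hy⟩ := hS
  have := Fintype.ofFinite σ
  exact MvPolynomial.funext fun z => by simpa using key Finset.univ y z hy (by simp)

/-- The image of a vector over `oddDenominators` in a field of characteristic zero. -/
def castVec (K : Type*) [Field K] (y : Fin 4 → oddDenominators) : Fin 4 → K :=
  fun i => ((y i : ℚ) : K)

theorem exists_isOddPoint_eval_ne_zero {K : Type*} [Field K] [CharZero K]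
    {p : MvPolynomial (Fin 4) K} (hp : p ≠ 0) :
    ∃ y, IsOddPoint y ∧ MvPolynomial.eval (castVec K y) p ≠ 0 := by
  by_contra! h
  refine hp (eq_zero_of_infinite_update (S := castVec K '' {y | IsOddPoint y})
    (Set.Nonempty.image _ exists_isOddPoint) ?_ ?_)
  · rintro _ ⟨y, hy, rfl⟩ i
    have hinj : Function.Injective fun t : oddDenominators => ((t : ℚ) : K) :=
      Rat.cast_injective.comp Subtype.val_injective
    refine ((IsOddPoint.infinite_update hy i).image hinj.injOn).mono ?_
    rintro _ ⟨t, ht, rfl⟩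
    refine ⟨Function.update y i t, ht, funext fun j => ?_⟩
    by_cases hj : j = i
    · subst hj; simp [castVec]
    · simp [castVec, hj]
  · rintro _ ⟨y, hy, rfl⟩
    exact h y hy

end

noncomputable section

/-! ### Polynomials on the double cover and their norms. -/

section DoubleCover

open MvPolynomial

variable {K : Type*} [Field K]

/-- As a polynomial in `X 3` it is linear, with relatively prime coefficients `X₀ + X₁ + X₂` and
`X₀X₁ + X₀X₂ + X₁X₂`. -/
theorem symTwo_X_prime : Prime (symTwo (X : Fin 4 → MvPolynomial (Fin 4) K)) := by
  have hlin : Irreducible (X 0 + X 1 + X 2 : MvPolynomial (Fin 4) K) := by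
    have := irreducible_mul_X_add (1 : MvPolynomial (Fin 4) K) (X 1 + X 2) 0 one_ne_zero
      (by simp) (fun h => by
        classical
        have h1 := vars_add_subset _ _ h
        simp at h1) isRelPrime_one_left
    rwa [one_mul, ← add_assoc] at this
  have hquad := irreducible_mul_X_add (X 0 + X 1 + X 2 : MvPolynomial (Fin 4) K)
    (X 0 * X 1 + X 0 * X 2 + X 1 * X 2) 3 hlin.ne_zero
    (fun h => by
      classical
      have h1 := vars_add_subset _ _ h
      simp only [Finset.mem_union, vars_X, Finset.mem_singleton] at h1
      rcases h1 with h1 | h1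
      · have h2 := vars_add_subset _ _ h1
        simp at h2
      · simp at h1)
    (fun h => by
      classical
      have hm : ∀ i j : Fin 4, 3 ∈ (X i * X j : MvPolynomial (Fin 4) K).vars → 3 = i ∨ 3 = j := by
        intro i j h
        have := vars_mul _ _ h
        simpa using this
      have h1 := vars_add_subset _ _ h
      rcases Finset.mem_union.1 h1 with h1 | h1
      · have h2 := vars_add_subset _ _ h1
        rcases Finset.mem_union.1 h2 with h2 | h2
        · have := hm _ _ h2; simp at this
        · have := hm _ _ h2; simp at this
      · have := hm _ _ h1; simp at this)
    (hlin.isRelPrime_iff_not_dvd.2 fun ⟨c, hc⟩ => by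
      -- At this point the linear form vanishes and the quadratic form is `-1`.
      have := congrArg (eval ![1, -1, 0, (0 : K)]) hc
      simp at this)
  rw [show symTwo (X : Fin 4 → MvPolynomial (Fin 4) K) = (X 0 + X 1 + X 2) * X 3
    + (X 0 * X 1 + X 0 * X 2 + X 1 * X 2) by rw [symTwo]; ring]
  exact hquad.prime

theorem eval_symTwo_X (y : Fin 4 → K) :
    eval y (symTwo (X : Fin 4 → MvPolynomial (Fin 4) K)) = symTwo y := by
  rw [symTwo_map]; simp

theorem eval_branchQuartic_X (y : Fin 4 → K) :
    eval y (branchQuartic (X : Fin 4 → MvPolynomial (Fin 4) K)) = branchQuartic y := by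
  rw [branchQuartic_map]; simp

theorem not_symTwo_X_dvd_branchQuartic_X [CharZero K] :
    ¬ symTwo (X : Fin 4 → MvPolynomial (Fin 4) K) ∣ branchQuartic X := by
  rintro ⟨c, hc⟩
  -- At this point `e₂ = 0` and `Q = 12`.
  have := congrArg (eval ![1, 1, 1, (-1 : K)]) hc
  rw [map_mul, eval_symTwo_X, eval_branchQuartic_X] at this
  simp [symTwo, branchQuartic, symOne, symThree] at this
  norm_num at this

/-- If `b ≠ 0`, the multiplicity of `p` is odd on the left and even on the right. This says that
`q/p` is not a square in the fraction field. -/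
theorem eq_zero_of_sq_mul_prime_eq {R : Type*} [CommRing R] [IsDomain R] [WfDvdMonoid R]
    {p q a b : R} (hp : Prime p) (hq : ¬ p ∣ q)
    (h : a ^ 2 * p = b ^ 2 * q) : a = 0 ∧ b = 0 := by
  have hq0 : q ≠ 0 := fun h => hq (h ▸ dvd_zero p)
  by_cases hb : b = 0
  · subst hb
    simpa [hp.ne_zero] using h
  exfalso
  have ha : a ≠ 0 := by
    rintro rfl
    simp [hb, hq0] at h
  have h1 : emultiplicity p (a ^ 2 * p) = emultiplicity p (b ^ 2 * q) := by rw [h]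
  have fa := FiniteMultiplicity.of_prime_left hp ha
  have fb := FiniteMultiplicity.of_prime_left hp hb
  rw [emultiplicity_mul hp, emultiplicity_mul hp, emultiplicity_pow hp, emultiplicity_pow hp,
    emultiplicity_eq_zero.2 hq, fa.emultiplicity_eq_multiplicity, fb.emultiplicity_eq_multiplicity,
    (FiniteMultiplicity.of_prime_left hp hp.ne_zero).emultiplicity_self] at h1
  norm_cast at h1
  omega

variable (K) in
/-- The equation of the double cover, as a polynomial in `w` over the coordinate ring of affine
space. -/
def doubleCover : Polynomial (MvPolynomial (Fin 4) K) :=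
  Polynomial.C (symTwo X) * Polynomial.X ^ 2 - Polynomial.C (branchQuartic X)

/-- Evaluation at a point `(y, w)`. -/
def evalPair (y : Fin 4 → K) (w : K) : Polynomial (MvPolynomial (Fin 4) K) →+* K :=
  Polynomial.eval₂RingHom (eval y) w

theorem evalPair_doubleCover (y : Fin 4 → K) (w : K) :
    evalPair y w (doubleCover K) = symTwo y * w ^ 2 - branchQuartic y := by
  simp [evalPair, doubleCover, eval_symTwo_X, eval_branchQuartic_X]

/-- The leading coefficient `e₂` of the equation is not a unit, so division with remainder needs a
power of it. -/
theorem exists_pseudo_division (H : Polynomial (MvPolynomial (Fin 4) K)) :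
    ∃ (n : ℕ) (a b : MvPolynomial (Fin 4) K) (q : Polynomial (MvPolynomial (Fin 4) K)),
      Polynomial.C (symTwo X ^ n) * H
        = Polynomial.C a + Polynomial.C b * Polynomial.X + doubleCover K * q := by
  induction H using Polynomial.induction_on with
  | C a => exact ⟨0, a, 0, 0, by simp⟩
  | add f g hf hg =>
    obtain ⟨n, a, b, q, h⟩ := hf
    obtain ⟨n', a', b', q', h'⟩ := hg
    refine ⟨n + n', symTwo X ^ n' * a + symTwo X ^ n * a', symTwo X ^ n' * b + symTwo X ^ n * b',
      Polynomial.C (symTwo X ^ n') * q + Polynomial.C (symTwo X ^ n) * q', ?_⟩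
    rw [pow_add]
    simp only [Polynomial.C_mul, Polynomial.C_add]
    linear_combination Polynomial.C (symTwo X ^ n') * h + Polynomial.C (symTwo X ^ n) * h'
  | monomial n r h =>
    obtain ⟨k, a, b, q, h⟩ := h
    refine ⟨k + 1, b * branchQuartic X, symTwo X * a,
      Polynomial.C b + Polynomial.C (symTwo X) * Polynomial.X * q, ?_⟩
    rw [pow_succ, pow_succ]
    simp only [Polynomial.C_mul]
    rw [doubleCover] at *
    linear_combination Polynomial.C (symTwo X) * Polynomial.X * h

/-- The polynomial `p` is, up to powers of `e₂`, the norm of `H`: for the remainder `a + bw`, it is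
`a²e₂ - b²Q = e₂(a - bw)(a + bw)` on the cover. It vanishes identically only if `a = b = 0`; then
the equation divides `e₂ⁿH`, and hence `H`, since `e₂` is prime and does not divide the equation. -/
theorem exists_ne_zero_of_not_doubleCover_dvd [CharZero K]
    {H : Polynomial (MvPolynomial (Fin 4) K)} (hH : ¬ doubleCover K ∣ H) :
    ∃ p : MvPolynomial (Fin 4) K, p ≠ 0 ∧ ∀ y w, symTwo y * w ^ 2 = branchQuartic y →
      evalPair y w H = 0 → eval y p = 0 := by
  obtain ⟨n, a, b, q, h⟩ := exists_pseudo_division H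
  refine ⟨a ^ 2 * symTwo X - b ^ 2 * branchQuartic X, fun h0 => hH ?_, fun y w hyw h0 => ?_⟩
  · obtain ⟨rfl, rfl⟩ := eq_zero_of_sq_mul_prime_eq symTwo_X_prime
      not_symTwo_X_dvd_branchQuartic_X (sub_eq_zero.1 h0)
    have hprime : Prime (Polynomial.C (symTwo (X : Fin 4 → MvPolynomial (Fin 4) K))) :=
      Polynomial.prime_C_iff.2 symTwo_X_prime
    have hnd : ¬ Polynomial.C (symTwo (X : Fin 4 → MvPolynomial (Fin 4) K)) ∣ doubleCover K := by
      intro hd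
      have h1 := (Polynomial.C_dvd_iff_dvd_coeff _ _).1 hd 0
      simp [doubleCover] at h1
      exact not_symTwo_X_dvd_branchQuartic_X h1
    have h2 : Polynomial.C (symTwo X) ^ n ∣ doubleCover K * q :=
      ⟨H, by simpa using h.symm⟩
    obtain ⟨r, rfl⟩ := hprime.pow_dvd_of_dvd_mul_left n hnd h2
    refine ⟨r, mul_left_cancel₀ (pow_ne_zero n hprime.ne_zero) ?_⟩
    rw [Polynomial.C_pow] at h
    rw [h]
    simp only [Polynomial.C_0]
    ring
  · have h1 := congrArg (evalPair y w) h
    rw [map_mul, h0, map_add, map_mul _ (doubleCover K), evalPair_doubleCover, hyw] at h1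
    simp [evalPair] at h1
    simp only [map_sub, map_mul, map_pow, eval_symTwo_X, eval_branchQuartic_X]
    rw [← hyw]
    linear_combination -(symTwo y) * (eval y a - eval y b * w) * h1

/-- Polynomials that are not multiples of the equation of the double cover are simultaneously
nonzero at some rational point of it with odd coordinates. -/
theorem exists_rational_point [CharZero K] {H₁ H₂ : Polynomial (MvPolynomial (Fin 4) K)}
    (h₁ : ¬ doubleCover K ∣ H₁) (h₂ : ¬ doubleCover K ∣ H₂) :
    ∃ (y : Fin 4 → ℚ) (w : ℚ), (∀ i, y i ≠ 0) ∧
      symTwo (fun i => (y i : K)) * (w : K) ^ 2 = branchQuartic (fun i => (y i : K)) ∧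
      evalPair (fun i => (y i : K)) w H₁ ≠ 0 ∧ evalPair (fun i => (y i : K)) w H₂ ≠ 0 := by
  obtain ⟨p₁, hp₁, e₁⟩ := exists_ne_zero_of_not_doubleCover_dvd h₁
  obtain ⟨p₂, hp₂, e₂⟩ := exists_ne_zero_of_not_doubleCover_dvd h₂
  obtain ⟨y, ⟨hodd, hne, v, hv⟩, hy⟩ := exists_isOddPoint_eval_ne_zero (mul_ne_zero hp₁ hp₂)
  rw [map_mul, mul_ne_zero_iff] at hy
  have hne' : symTwo (fun i => (y i : ℚ)) ≠ 0 := by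
    have := symTwo_map oddDenominators.subtype y
    simp only [Subring.subtype_apply] at this
    rw [← this]
    simpa using hne
  have hv' : symTwo (fun i => (y i : ℚ)) * branchQuartic (fun i => (y i : ℚ)) = v * v := by
    have e1 := symTwo_map oddDenominators.subtype y
    have e2 := branchQuartic_map oddDenominators.subtype y
    simp only [Subring.subtype_apply] at e1 e2
    rw [← e1, ← e2, ← hv]
    simp
  have hw : symTwo (fun i => (y i : ℚ)) * (v / symTwo (fun i => (y i : ℚ))) ^ 2
      = branchQuartic (fun i => (y i : ℚ)) := by
    field_simp
    linear_combination -hv'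
  have hK := congrArg (algebraMap ℚ K) hw
  rw [map_mul, map_pow, symTwo_map (algebraMap ℚ K), branchQuartic_map (algebraMap ℚ K)] at hK
  simp only [eq_ratCast] at hK
  refine ⟨fun i => y i, v / symTwo (fun i => (y i : ℚ)), fun i => ?_, hK, fun h0 => ?_, fun h0 => ?_⟩
  · have := oddDenominators.ne_zero_of_odd (hodd i)
    simpa using this
  · exact hy.1 (e₁ _ _ hK h0)
  · exact hy.2 (e₂ _ _ hK h0)

end DoubleCover

end

noncomputable section

/-! ### Principal open sets, closure and irreducibility in the Zariski topology. -/

section Zariski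

variable {k K : Type*} [Field k] [Field K] [Algebra k K] {n m : ℕ}

/-- The value of `F` at a vector of projective coordinates and a point of affine space. -/
def affineValue (F : ProjAffPoly k n m) (x : Fin (n + 1) → K) (a : Fin m → K) : K :=
  MvPolynomial.eval₂ (MvPolynomial.aeval a : MvPolynomial (Fin m) k →ₐ[k] K).toRingHom x F

theorem valueAt_eq_affineValue (F : ProjAffPoly k n m) (p : ProjAff K n m) :
    valueAt F p = affineValue F p.1.rep p.2 := rfl

theorem affineValue_smul {F : ProjAffPoly k n m} {d : ℕ} (hF : F.IsHomogeneous d) (c : K)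
    (x : Fin (n + 1) → K) (a : Fin m → K) :
    affineValue F (c • x) a = c ^ d * affineValue F x a := by
  rw [affineValue, affineValue, MvPolynomial.eval₂_eq, MvPolynomial.eval₂_eq, Finset.mul_sum]
  refine Finset.sum_congr rfl fun e he => ?_
  have h1 : ∑ i, e i = d := by
    have := hF (MvPolynomial.mem_support_iff.1 he)
    rw [Finsupp.weight_apply, Finsupp.sum_fintype _ _ (by simp)] at this
    simpa using this
  have h2 : ∏ i ∈ e.support, (c • x) i ^ e i = c ^ d * ∏ i ∈ e.support, x i ^ e i := by
    have h3 : ∀ z : Fin (n + 1) → K, ∏ i ∈ e.support, z i ^ e i = ∏ i, z i ^ e i := fun z =>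
      Finset.prod_subset (Finset.subset_univ _) (by simp +contextual)
    rw [h3, h3, ← h1, ← Finset.prod_pow_eq_pow_sum, ← Finset.prod_mul_distrib]
    simp [mul_pow]
  rw [h2]
  ring

theorem exists_valueAt_mk (x : Fin (n + 1) → K) (hx : x ≠ 0) (a : Fin m → K) :
    ∃ c : K, c ≠ 0 ∧ ∀ (d : ℕ) (F : ProjAffPoly k n m), F.IsHomogeneous d →
      valueAt F (Projectivization.mk K x hx, a) = c ^ d * affineValue F x a := by
  obtain ⟨c, hc⟩ := Projectivization.exists_smul_eq_mk_rep K x hx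
  refine ⟨c, c.ne_zero, fun d F hF => ?_⟩
  rw [valueAt_eq_affineValue, ← affineValue_smul hF]
  change affineValue F (Projectivization.mk K x hx).rep a = _
  rw [← hc]
  rfl

theorem valueAt_mk_ne_zero_iff {x : Fin (n + 1) → K} (hx : x ≠ 0) (a : Fin m → K) {d : ℕ}
    {F : ProjAffPoly k n m} (hF : F.IsHomogeneous d) :
    valueAt F (Projectivization.mk K x hx, a) ≠ 0 ↔ affineValue F x a ≠ 0 := by
  obtain ⟨c, hc, h⟩ := exists_valueAt_mk (k := k) x hx a
  rw [h d F hF]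
  simp [hc]

theorem valueAt_mk_eq_zero_iff {x : Fin (n + 1) → K} (hx : x ≠ 0) (a : Fin m → K) {d : ℕ}
    {F : ProjAffPoly k n m} (hF : F.IsHomogeneous d) :
    valueAt F (Projectivization.mk K x hx, a) = 0 ↔ affineValue F x a = 0 :=
  not_iff_not.1 (valueAt_mk_ne_zero_iff hx a hF)

theorem affineValue_mul (F G : ProjAffPoly k n m) (x : Fin (n + 1) → K) (a : Fin m → K) :
    affineValue (F * G) x a = affineValue F x a * affineValue G x a := by
  simp [affineValue, MvPolynomial.eval₂_mul]

variable (k K) in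
theorem isTopologicalBasis_zariski (n m : ℕ) :
    @TopologicalSpace.IsTopologicalBasis _ (zariski k K n m)
      {U | ∃ (d : ℕ) (F : ProjAffPoly k n m), F.IsHomogeneous d ∧ U = {p | valueAt F p ≠ 0}} := by
  refine @TopologicalSpace.IsTopologicalBasis.mk _ (zariski k K n m) _ ?_ ?_ rfl
  · rintro _ ⟨d, F, hF, rfl⟩ _ ⟨e, G, hG, rfl⟩ p hp
    refine ⟨_, ⟨d + e, F * G, hF.mul hG, rfl⟩, ?_, ?_⟩
    · rw [Set.mem_ofPred_eq, valueAt_eq_affineValue, affineValue_mul]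
      exact mul_ne_zero hp.1 hp.2
    · intro q hq
      rw [Set.mem_ofPred_eq, valueAt_eq_affineValue, affineValue_mul, mul_ne_zero_iff] at hq
      exact hq
  · refine Set.eq_univ_of_forall fun p => ⟨_, ⟨0, 1, MvPolynomial.isHomogeneous_one _ _, rfl⟩, ?_⟩
    simp [valueAt_eq_affineValue, affineValue]

theorem mem_closure_zariski_iff {S : Set (ProjAff K n m)} {p : ProjAff K n m} :
    p ∈ closure[zariski k K n m] S ↔ ∀ (d : ℕ) (F : ProjAffPoly k n m), F.IsHomogeneous d →
      valueAt F p ≠ 0 → ∃ q ∈ S, valueAt F q ≠ 0 := by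
  rw [@TopologicalSpace.IsTopologicalBasis.mem_closure_iff _ (zariski k K n m) _
    (isTopologicalBasis_zariski k K n m)]
  constructor
  · intro h d F hF hp
    obtain ⟨q, hq, hS⟩ := h _ ⟨d, F, hF, rfl⟩ hp
    exact ⟨q, hS, hq⟩
  · rintro h _ ⟨d, F, hF, rfl⟩ hp
    obtain ⟨q, hS, hq⟩ := h d F hF hp
    exact ⟨q, hq, hS⟩

theorem isIrreducible_zariski {S : Set (ProjAff K n m)} (hS : S.Nonempty)
    (h : ∀ (d e : ℕ) (F G : ProjAffPoly k n m), F.IsHomogeneous d → G.IsHomogeneous e →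
      (∃ p ∈ S, valueAt F p ≠ 0) → (∃ p ∈ S, valueAt G p ≠ 0) →
      ∃ p ∈ S, valueAt F p ≠ 0 ∧ valueAt G p ≠ 0) :
    @IsIrreducible _ (zariski k K n m) S := by
  let := zariski k K n m
  refine ⟨hS, fun U V hU hV ⟨p, hpS, hpU⟩ ⟨q, hqS, hqV⟩ => ?_⟩
  obtain ⟨_, ⟨d, F, hF, rfl⟩, hpF, hFU⟩ :=
    (isTopologicalBasis_zariski k K n m).exists_subset_of_mem_open hpU hU
  obtain ⟨_, ⟨e, G, hG, rfl⟩, hqG, hGV⟩ :=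
    (isTopologicalBasis_zariski k K n m).exists_subset_of_mem_open hqV hV
  obtain ⟨r, hr, h1, h2⟩ := h d e F G hF hG ⟨p, hpS, hpF⟩ ⟨q, hqS, hqG⟩
  exact ⟨r, hr, hFU h1, hGV h2⟩

/-- A nonempty principal open subset of an irreducible set is dense in it. -/
theorem subset_closure_inter_of_isIrreducible {S : Set (ProjAff K n m)}
    (hS : @IsIrreducible _ (zariski K K n m) S) {d : ℕ} {F : ProjAffPoly K n m}
    (hF : F.IsHomogeneous d) (hne : ∃ p ∈ S, valueAt F p ≠ 0) :
    S ⊆ closure[zariski K K n m] (S ∩ {p | valueAt F p ≠ 0}) := by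
  intro p hp
  rw [mem_closure_zariski_iff]
  intro e G hG hpG
  obtain ⟨q, hq, hqF⟩ := hne
  obtain ⟨r, hr, h1, h2⟩ := hS.2 _ _
    (TopologicalSpace.isOpen_generateFrom_of_mem ⟨e, G, hG, rfl⟩)
    (TopologicalSpace.isOpen_generateFrom_of_mem ⟨d, F, hF, rfl⟩) ⟨p, hp, hpG⟩ ⟨q, hq, hqF⟩
  exact ⟨r, ⟨hr, h2⟩, h1⟩

end Zariski

/-! ### The symmetric Burkhardt quartic as a double cover: irreducibility and density of rational
points. -/

section Coordinates

variable {K : Type*} [Field K]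

/-- The vector with coordinates `x₃, …, x₆ = y` and `x₁ - x₂ = w` and coordinate sum zero. -/
def burkhardtVector (y : Fin 4 → K) (w : K) : Fin 6 → K :=
  ![(w - symOne y) / 2, (-w - symOne y) / 2, y 0, y 1, y 2, y 3]

theorem eq_burkhardtVector [CharZero K] {x : Fin 6 → K} (hx : ∑ i, x i = 0) :
    x = burkhardtVector ![x 2, x 3, x 4, x 5] (x 0 - x 1) := by
  simp only [Fin.sum_univ_six] at hx
  funext i
  fin_cases i
  · simp [burkhardtVector, symOne]; linear_combination hx / 2
  · simp [burkhardtVector, symOne]; linear_combination hx / 2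
  all_goals simp [burkhardtVector]

theorem sum_burkhardtVector [CharZero K] (y : Fin 4 → K) (w : K) :
    ∑ i, burkhardtVector y w i = 0 := by
  simp [Fin.sum_univ_six, burkhardtVector, symOne]
  ring

theorem affineValue_esymm {k : Type*} [Field k] [Algebra k K] {n m : ℕ} (r : ℕ)
    (x : Fin (n + 1) → K) (a : Fin m → K) :
    affineValue (MvPolynomial.esymm (Fin (n + 1)) (MvPolynomial (Fin m) k) r : ProjAffPoly k n m) x a
      = (Finset.univ.val.map x).esymm r := by
  rw [Finset.esymm_map_val, affineValue, MvPolynomial.esymm, MvPolynomial.eval₂_sum]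
  simp [MvPolynomial.eval₂_prod]

/-- Expand `σ₄ = x₁x₂e₂ + (x₁ + x₂)e₃ + e₄` with `x₁ + x₂ = -e₁` and `4x₁x₂ = e₁² - w²`. -/
theorem esymm_four_burkhardtVector [CharZero K] (y : Fin 4 → K) (w : K) :
    4 * (Finset.univ.val.map (burkhardtVector y w)).esymm 4
      = branchQuartic y - symTwo y * w ^ 2 := by
  have h : (Finset.univ : Finset (Fin 6)).val = {0, 1, 2, 3, 4, 5} := rfl
  rw [h]
  simp [Multiset.esymm, Multiset.powersetCard_cons, Multiset.powersetCard_one, burkhardtVector, Multiset.insert_eq_cons]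
  rw [symTwo, branchQuartic, symOne, symTwo, symThree]
  ring

theorem mem_symmetricBurkhardt_iff [Algebra ℚ K] (p : ProjAff K 5 0) :
    p ∈ symmetricBurkhardt K ↔
      ∑ i, p.1.rep i = 0 ∧ (Finset.univ.val.map p.1.rep).esymm 4 = 0 := by
  rw [symmetricBurkhardt, Set.mem_ofPred_eq, valueAt_eq_affineValue, valueAt_eq_affineValue,
    affineValue_esymm, affineValue_esymm, Finset.esymm_map_val, Finset.powersetCard_one]
  simp

theorem esymm_isHomogeneous {σ R : Type*} [CommRing R] [Fintype σ] (r : ℕ) :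
    (MvPolynomial.esymm σ R r).IsHomogeneous r := by
  rw [MvPolynomial.esymm]
  refine MvPolynomial.IsHomogeneous.sum _ _ _ fun t ht => ?_
  have := MvPolynomial.IsHomogeneous.prod t (fun i => (MvPolynomial.X i : MvPolynomial σ R))
    (fun _ => 1) fun i _ => MvPolynomial.isHomogeneous_X _ _
  simpa [(Finset.mem_powersetCard.1 ht).2] using this

theorem mk_mem_symmetricBurkhardt_iff [Algebra ℚ K] {x : Fin 6 → K} (hx : x ≠ 0) (a : Fin 0 → K) :
    (Projectivization.mk K x hx, a) ∈ symmetricBurkhardt K ↔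
      ∑ i, x i = 0 ∧ (Finset.univ.val.map x).esymm 4 = 0 := by
  rw [symmetricBurkhardt, Set.mem_ofPred_eq, valueAt_mk_eq_zero_iff hx a (esymm_isHomogeneous 1),
    valueAt_mk_eq_zero_iff hx a (esymm_isHomogeneous 4),
    affineValue_esymm, affineValue_esymm, Finset.esymm_map_val, Finset.powersetCard_one]
  simp

variable (K) in
/-- Substitution of the coordinates `(y, w)` into forms on `ℙ⁵`. -/
def toDoubleCover : ProjAffPoly K 5 0 →+* Polynomial (MvPolynomial (Fin 4) K) :=
  let c : K →+* Polynomial (MvPolynomial (Fin 4) K) := Polynomial.C.comp MvPolynomial.C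
  let w : Polynomial (MvPolynomial (Fin 4) K) := Polynomial.X
  let y : Fin 4 → Polynomial (MvPolynomial (Fin 4) K) := fun i => Polynomial.C (MvPolynomial.X i)
  MvPolynomial.eval₂Hom (MvPolynomial.eval₂Hom c Fin.elim0)
    ![(w - symOne y) * c 2⁻¹, (-w - symOne y) * c 2⁻¹, y 0, y 1, y 2, y 3]

theorem evalPair_toDoubleCover (G : ProjAffPoly K 5 0) (y : Fin 4 → K) (w : K) (a : Fin 0 → K) :
    evalPair y w (toDoubleCover K G) = affineValue G (burkhardtVector y w) a := by
  have : (evalPair y w).comp (toDoubleCover K) = MvPolynomial.eval₂Hom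
      (MvPolynomial.aeval a : MvPolynomial (Fin 0) K →ₐ[K] K).toRingHom (burkhardtVector y w) := by
    apply MvPolynomial.ringHom_ext
    · intro r
      obtain ⟨r, rfl⟩ := MvPolynomial.C_surjective (Fin 0) r
      simp [evalPair, toDoubleCover]
    · intro i
      fin_cases i <;> simp [evalPair, toDoubleCover, burkhardtVector, symOne, div_eq_mul_inv]
  exact congrArg (fun f => f G) this

theorem not_doubleCover_dvd_toDoubleCover [Algebra ℚ K] [CharZero K] {G : ProjAffPoly K 5 0}
    {p : ProjAff K 5 0} (hp : p ∈ symmetricBurkhardt K) (hG : valueAt G p ≠ 0) :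
    ¬ doubleCover K ∣ toDoubleCover K G := by
  rw [mem_symmetricBurkhardt_iff] at hp
  rintro ⟨q, hq⟩
  have hx := eq_burkhardtVector hp.1
  rw [valueAt_eq_affineValue, hx, ← evalPair_toDoubleCover, hq, map_mul, evalPair_doubleCover] at hG
  have h4 := hp.2
  rw [hx] at h4
  have := esymm_four_burkhardtVector ![p.1.rep 2, p.1.rep 3, p.1.rep 4, p.1.rep 5]
    (p.1.rep 0 - p.1.rep 1)
  rw [h4, mul_zero] at this
  refine hG (mul_eq_zero_of_left ?_ _)
  linear_combination this

/-- Two forms that do not vanish on the quartic are both nonzero at a rational point of it. -/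
theorem exists_rational_point_symmetricBurkhardt [Algebra ℚ K] [CharZero K] {d e : ℕ}
    {F G : ProjAffPoly K 5 0} (hF : F.IsHomogeneous d) (hG : G.IsHomogeneous e)
    (hpF : ∃ p ∈ symmetricBurkhardt K, valueAt F p ≠ 0)
    (hpG : ∃ p ∈ symmetricBurkhardt K, valueAt G p ≠ 0) :
    ∃ p ∈ symmetricBurkhardt K ∩ rationalPoints ℚ K 5 0, valueAt F p ≠ 0 ∧ valueAt G p ≠ 0 := by
  obtain ⟨p₁, h₁, h₁'⟩ := hpF
  obtain ⟨p₂, h₂, h₂'⟩ := hpG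
  obtain ⟨y, w, hy, hyw, hF', hG'⟩ := exists_rational_point
    (not_doubleCover_dvd_toDoubleCover h₁ h₁') (not_doubleCover_dvd_toDoubleCover h₂ h₂')
  rw [evalPair_toDoubleCover _ _ _ Fin.elim0] at hF' hG'
  have hcast : (fun i => algebraMap ℚ K (burkhardtVector y w i))
      = burkhardtVector (fun i => (y i : K)) (w : K) := by
    funext i
    fin_cases i <;> simp [burkhardtVector, symOne]
  have hne : burkhardtVector (fun i => (y i : K)) (w : K) ≠ 0 := fun h => hy 0 (by
    have := congrFun h 2
    simpa [burkhardtVector] using this)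
  refine ⟨(Projectivization.mk K _ hne, Fin.elim0), ⟨?_, ?_⟩, ?_, ?_⟩
  · rw [mk_mem_symmetricBurkhardt_iff]
    refine ⟨sum_burkhardtVector _ _, ?_⟩
    have := esymm_four_burkhardtVector (fun i => (y i : K)) (w : K)
    rw [← hyw, sub_self] at this
    simpa using this
  · refine ⟨burkhardtVector y w, Fin.elim0, hcast ▸ hne, ?_⟩
    exact Prod.ext (by simp only [hcast]) (funext fun i => i.elim0)
  · exact (valueAt_mk_ne_zero_iff hne _ hF).2 hF'
  · exact (valueAt_mk_ne_zero_iff hne _ hG).2 hG'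

/-- The condition on the coordinate `x₅` is for the birational map: it shows that the chart `x₅ ≠ 0`
meets the quartic. -/
theorem symmetricBurkhardt_nonempty [Algebra ℚ K] [CharZero K] :
    ∃ p ∈ symmetricBurkhardt K, p.1.rep 4 ≠ 0 := by
  have h0 : (![0, 0, 0, 0, 1, -1] : Fin 6 → K) ≠ 0 := fun h => by
    have := congrFun h 4
    simp at this
  have hx := eq_burkhardtVector (K := K) (x := ![0, 0, 0, 0, 1, -1]) (by simp [Fin.sum_univ_six])
  refine ⟨(Projectivization.mk K _ h0, Fin.elim0), ?_, ?_⟩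
  · rw [mk_mem_symmetricBurkhardt_iff]
    refine ⟨by simp [Fin.sum_univ_six], ?_⟩
    have := esymm_four_burkhardtVector (K := K) ![0, 0, 1, -1] 0
    rw [hx]
    simpa [branchQuartic, symOne, symThree] using this
  · obtain ⟨c, hc⟩ := Projectivization.exists_smul_eq_mk_rep K _ h0
    change (Projectivization.mk K _ h0).rep 4 ≠ 0
    rw [← hc]
    simp [Units.smul_def]

theorem isIrreducible_symmetricBurkhardt [Algebra ℚ K] [CharZero K] :
    @IsIrreducible _ (zariski K K 5 0) (symmetricBurkhardt K) := by
  refine isIrreducible_zariski (symmetricBurkhardt_nonempty.imp fun _ h => h.1) ?_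
  intro d e F G hF hG hpF hpG
  obtain ⟨p, hp, h⟩ := exists_rational_point_symmetricBurkhardt hF hG hpF hpG
  exact ⟨p, hp.1, h⟩

theorem symmetricBurkhardt_subset_closure_rationalPoints [Algebra ℚ K] [CharZero K] :
    symmetricBurkhardt K ⊆
      closure[zariski K K 5 0] (symmetricBurkhardt K ∩ rationalPoints ℚ K 5 0) := by
  intro p hp
  rw [mem_closure_zariski_iff]
  intro d F hF hpF
  obtain ⟨q, hq, h, -⟩ := exists_rational_point_symmetricBurkhardt hF hF ⟨p, hp, hpF⟩ ⟨p, hp, hpF⟩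
  exact ⟨q, hq, h⟩

end Coordinates

end

noncomputable section

/-! ### The cubic threefold: comparison with the double cover, and irreducibility. -/

section CubicThreefold

/-- The value of the cubic form. -/
def cubicValue {R : Type*} [CommRing R] (u v X Y Z : R) : R :=
  (u + v - 1) * (X * Y * (X + Y)) + (-(u * v) + u + v) * ((X ^ 2 + Y ^ 2) * Z)
    + (-u ^ 2 - 3 * u * v + 3 * u - v ^ 2 + 3 * v - 1) * (X * Y * Z)
    + (u ^ 2 * v + u * v ^ 2 - u * v) * Z ^ 3
    + (u ^ 2 * v - u ^ 2 + u * v ^ 2 - 3 * u * v + u - v ^ 2 + v) * ((X + Y) * Z ^ 2)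

theorem cubicForm_eq_cubicValue {R : Type*} [CommRing R] (u v : R) :
    cubicForm u v = cubicValue (MvPolynomial.C u) (MvPolynomial.C v) (MvPolynomial.X 0)
      (MvPolynomial.X 1) (MvPolynomial.X 2) := by
  simp only [cubicForm, cubicValue, map_add, map_sub, map_mul, map_pow, map_neg, map_one, map_ofNat]

theorem cubicValue_map {R S : Type*} [CommRing R] [CommRing S] (f : R →+* S) (u v X Y Z : R) :
    f (cubicValue u v X Y Z) = cubicValue (f u) (f v) (f X) (f Y) (f Z) := by
  simp only [cubicValue, map_add, map_sub, map_mul, map_pow, map_neg, map_one, map_ofNat]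

theorem cubicForm_isHomogeneous {R : Type*} [CommRing R] (u v : R) :
    (cubicForm u v).IsHomogeneous 3 := by
  have hX : ∀ i : Fin 3, (MvPolynomial.X i : MvPolynomial (Fin 3) R).IsHomogeneous 1 :=
    MvPolynomial.isHomogeneous_X R
  have hC : ∀ (r : R) {F : MvPolynomial (Fin 3) R}, F.IsHomogeneous 3 →
      (MvPolynomial.C r * F).IsHomogeneous 3 := fun r F hF => by
    simpa using (MvPolynomial.isHomogeneous_C (Fin 3) r).mul hF
  rw [cubicForm]
  refine ((((hC _ ?_).add (hC _ ?_)).add (hC _ ?_)).add (hC _ ?_)).add (hC _ ?_)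
  · exact ((hX 0).mul (hX 1)).mul ((hX 0).add (hX 1))
  · exact (((hX 0).pow 2).add ((hX 1).pow 2)).mul (hX 2)
  · exact ((hX 0).mul (hX 1)).mul (hX 2)
  · exact (hX 2).pow 3
  · exact ((hX 0).add (hX 1)).mul ((hX 2).pow 2)

variable {K : Type*} [Field K]

theorem affineValue_cubicForm {k : Type*} [Field k] [Algebra k K] (x : Fin 3 → K) (a : Fin 2 → K) :
    affineValue (cubicForm (MvPolynomial.X 0) (MvPolynomial.X 1) : ProjAffPoly k 2 2) x a
      = cubicValue (a 0) (a 1) (x 0) (x 1) (x 2) := by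
  rw [cubicForm_eq_cubicValue]
  change MvPolynomial.eval₂Hom _ _ _ = _
  rw [cubicValue_map]
  simp

theorem mem_cubicThreefold_iff [Algebra ℚ K] (p : ProjAff K 2 2) :
    p ∈ cubicThreefold K ↔
      cubicValue (p.2 0) (p.2 1) (p.1.rep 0) (p.1.rep 1) (p.1.rep 2) = 0 := by
  rw [cubicThreefold, Set.mem_ofPred_eq, valueAt_eq_affineValue, affineValue_cubicForm]

theorem mk_mem_cubicThreefold_iff [Algebra ℚ K] {x : Fin 3 → K} (hx : x ≠ 0) (a : Fin 2 → K) :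
    (Projectivization.mk K x hx, a) ∈ cubicThreefold K ↔
      cubicValue (a 0) (a 1) (x 0) (x 1) (x 2) = 0 := by
  rw [cubicThreefold, Set.mem_ofPred_eq,
    valueAt_mk_eq_zero_iff hx a (cubicForm_isHomogeneous _ _), affineValue_cubicForm]

/-- The last four coordinates of the embedded plane. -/
def planeCoordinates {R : Type*} [CommRing R] (u v X Y Z : R) : Fin 4 → R :=
  ![-u * Z, -v * Z, Z, -X - Y + (u + v - 1) * Z]

theorem doubleCover_planeCoordinates {R : Type*} [CommRing R] (u v X Y Z : R) :
    symTwo (planeCoordinates u v X Y Z) * (X - Y) ^ 2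
      - branchQuartic (planeCoordinates u v X Y Z) = -4 * (Z * cubicValue u v X Y Z) := by
  simp only [symTwo, branchQuartic, symOne, symThree, planeCoordinates, cubicValue,
    Matrix.cons_val]
  ring

theorem planeEmbedding_eq_burkhardtVector [CharZero K] (u v : K) (x : Fin 3 → K) :
    planeEmbedding u v x
      = burkhardtVector (planeCoordinates u v (x 0) (x 1) (x 2)) (x 0 - x 1) := by
  funext i
  fin_cases i <;> simp [planeEmbedding, burkhardtVector, planeCoordinates, symOne]
  all_goals ring

theorem esymm_four_planeEmbedding [CharZero K] (u v : K) (x : Fin 3 → K) :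
    (Finset.univ.val.map (planeEmbedding u v x)).esymm 4
      = x 2 * cubicValue u v (x 0) (x 1) (x 2) := by
  have h1 := esymm_four_burkhardtVector (planeCoordinates u v (x 0) (x 1) (x 2)) (x 0 - x 1)
  have h2 := doubleCover_planeCoordinates u v (x 0) (x 1) (x 2)
  rw [planeEmbedding_eq_burkhardtVector]
  have h4 : (4 : K) ≠ 0 := by norm_num
  refine mul_left_cancel₀ h4 ?_
  linear_combination h1 - h2

theorem sum_planeEmbedding (u v : K) (x : Fin 3 → K) : ∑ i, planeEmbedding u v x i = 0 := by
  simp [Fin.sum_univ_six, planeEmbedding]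
  ring

variable (K) in
/-- Substitution of the plane coordinates into polynomials in `(y, w)`. -/
def ofDoubleCover : Polynomial (MvPolynomial (Fin 4) K) →+* ProjAffPoly K 2 2 :=
  Polynomial.eval₂RingHom
    (MvPolynomial.eval₂Hom (MvPolynomial.C.comp MvPolynomial.C)
      (planeCoordinates (MvPolynomial.C (MvPolynomial.X 0)) (MvPolynomial.C (MvPolynomial.X 1))
        (MvPolynomial.X 0) (MvPolynomial.X 1) (MvPolynomial.X 2)))
    (MvPolynomial.X 0 - MvPolynomial.X 1)

theorem ofDoubleCover_doubleCover :
    ofDoubleCover K (doubleCover K) = -4 * (MvPolynomial.X 2 *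
      cubicForm (MvPolynomial.X 0) (MvPolynomial.X 1)) := by
  rw [cubicForm_eq_cubicValue, ← doubleCover_planeCoordinates, doubleCover, map_sub, map_mul,
    map_pow]
  simp only [ofDoubleCover, Polynomial.coe_eval₂RingHom, Polynomial.eval₂_C, Polynomial.eval₂_X,
    symTwo_map, branchQuartic_map, MvPolynomial.coe_eval₂Hom, MvPolynomial.eval₂_X]

theorem affineValue_ofDoubleCover (H : Polynomial (MvPolynomial (Fin 4) K)) (x : Fin 3 → K)
    (a : Fin 2 → K) :
    affineValue (ofDoubleCover K H) x a
      = evalPair (planeCoordinates (a 0) (a 1) (x 0) (x 1) (x 2)) (x 0 - x 1) H := by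
  have : (MvPolynomial.eval₂Hom (MvPolynomial.aeval a : MvPolynomial (Fin 2) K →ₐ[K] K).toRingHom
      x).comp (ofDoubleCover K)
      = evalPair (planeCoordinates (a 0) (a 1) (x 0) (x 1) (x 2)) (x 0 - x 1) := by
    apply Polynomial.ringHom_ext'
    · apply MvPolynomial.ringHom_ext
      · intro r
        simp [ofDoubleCover, evalPair]
      · intro i
        fin_cases i <;> simp [ofDoubleCover, evalPair, planeCoordinates]
    · simp [ofDoubleCover, evalPair]
  exact congrArg (fun f => f H) this

/-- The coordinates `X`, `Y`, `Z` are linear in `(y, w)`, while `u` and `v` are `-y₀/y₂` and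
`-y₁/y₂` with `y₂ = Z`. Only powers of `Z` are needed as denominators. -/
theorem exists_ofDoubleCover_eq [CharZero K] (G : ProjAffPoly K 2 2) :
    ∃ (N : ℕ) (H : Polynomial (MvPolynomial (Fin 4) K)),
      ofDoubleCover K H = MvPolynomial.X 2 ^ N * G := by
  have hX : ∀ i : Fin 4, ofDoubleCover K (Polynomial.C (MvPolynomial.X i))
      = planeCoordinates (R := ProjAffPoly K 2 2) (MvPolynomial.C (MvPolynomial.X 0))
        (MvPolynomial.C (MvPolynomial.X 1)) (MvPolynomial.X 0) (MvPolynomial.X 1)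
        (MvPolynomial.X 2) i := by
    intro i
    simp [ofDoubleCover]
  have hC : ∀ r : K, ofDoubleCover K (Polynomial.C (MvPolynomial.C r))
      = MvPolynomial.C (MvPolynomial.C r) := by
    intro r
    simp [ofDoubleCover]
  have hW : ofDoubleCover K Polynomial.X = MvPolynomial.X 0 - MvPolynomial.X 1 := by
    simp [ofDoubleCover]
  have h2 : (MvPolynomial.C (MvPolynomial.C (2⁻¹ : K)) : ProjAffPoly K 2 2) * 2 = 1 := by
    rw [show (2 : ProjAffPoly K 2 2) = MvPolynomial.C (MvPolynomial.C (2 : K)) by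
      rw [map_ofNat, map_ofNat],
      ← map_mul, ← map_mul]
    simp
  have hadd : ∀ f g : ProjAffPoly K 2 2,
      (∃ (N : ℕ) (H : Polynomial (MvPolynomial (Fin 4) K)),
        ofDoubleCover K H = MvPolynomial.X 2 ^ N * f) →
      (∃ (N : ℕ) (H : Polynomial (MvPolynomial (Fin 4) K)),
        ofDoubleCover K H = MvPolynomial.X 2 ^ N * g) →
      ∃ (N : ℕ) (H : Polynomial (MvPolynomial (Fin 4) K)),
        ofDoubleCover K H = MvPolynomial.X 2 ^ N * (f + g) := by
    rintro f g ⟨N, H, h⟩ ⟨N', H', h'⟩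
    refine ⟨N + N', Polynomial.C (MvPolynomial.X 2) ^ N' * H
      + Polynomial.C (MvPolynomial.X 2) ^ N * H', ?_⟩
    rw [map_add, map_mul, map_mul, map_pow, map_pow, hX, h, h']
    simp only [planeCoordinates, Matrix.cons_val]
    ring
  induction G using MvPolynomial.induction_on with
  | C a =>
    induction a using MvPolynomial.induction_on with
    | C r => exact ⟨0, _, (hC r).trans (by simp)⟩
    | add f g hf hg => rw [map_add]; exact hadd _ _ hf hg
    | mul_X f i hf =>
      obtain ⟨N, H, h⟩ := hf
      have : ∃ j : Fin 4, ofDoubleCover K (Polynomial.C (MvPolynomial.X j))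
          = -MvPolynomial.C (MvPolynomial.X i) * MvPolynomial.X 2 := by
        fin_cases i
        · exact ⟨0, by rw [hX]; simp [planeCoordinates]⟩
        · exact ⟨1, by rw [hX]; simp [planeCoordinates]⟩
      obtain ⟨j, hj⟩ := this
      refine ⟨N + 1, -(H * Polynomial.C (MvPolynomial.X j)), ?_⟩
      rw [map_neg, map_mul, h, hj, map_mul]
      ring
  | add f g hf hg => exact hadd _ _ hf hg
  | mul_X f i hf =>
    obtain ⟨N, H, h⟩ := hf
    have : ∃ L : Polynomial (MvPolynomial (Fin 4) K), ofDoubleCover K L = MvPolynomial.X i := by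
      let y : Fin 4 → Polynomial (MvPolynomial (Fin 4) K) := fun i =>
        Polynomial.C (MvPolynomial.X i)
      have hs : ofDoubleCover K (symOne y) = -MvPolynomial.X 0 - MvPolynomial.X 1 := by
        simp only [symOne, map_add, y, hX]
        simp only [planeCoordinates, Matrix.cons_val]
        ring
      fin_cases i
      · refine ⟨Polynomial.C (MvPolynomial.C 2⁻¹) * (Polynomial.X - symOne y), ?_⟩
        rw [map_mul, map_sub, hC, hW, hs]
        simp only [Fin.zero_eta]
        linear_combination (MvPolynomial.X 0 : ProjAffPoly K 2 2) * h2
      · refine ⟨Polynomial.C (MvPolynomial.C 2⁻¹) * (-Polynomial.X - symOne y), ?_⟩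
        rw [map_mul, map_sub, map_neg, hC, hW, hs]
        simp only [Fin.mk_one]
        linear_combination (MvPolynomial.X 1 : ProjAffPoly K 2 2) * h2
      · exact ⟨y 2, by simp only [y, hX]; simp [planeCoordinates]⟩
    obtain ⟨L, hL⟩ := this
    exact ⟨N, H * L, by rw [map_mul, h, hL]; ring⟩

/-- The equation of the double cover pulls back to `-4Z` times the cubic form. As the prime `Z` does
not divide the cubic form, divisibility of `H` would make `G` a multiple of the cubic form, contrary
to its nonvanishing at a point of the threefold. -/
theorem exists_not_doubleCover_dvd [Algebra ℚ K] [CharZero K] {G : ProjAffPoly K 2 2}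
    (hG : ∃ p ∈ cubicThreefold K, valueAt G p ≠ 0) :
    ∃ (N : ℕ) (H : Polynomial (MvPolynomial (Fin 4) K)),
      ofDoubleCover K H = MvPolynomial.X 2 ^ N * G ∧ ¬ doubleCover K ∣ H := by
  obtain ⟨p, hp, hGp⟩ := hG
  obtain ⟨N, H, h⟩ := exists_ofDoubleCover_eq G
  refine ⟨N, H, h, ?_⟩
  rintro ⟨q, rfl⟩
  have hprime : Prime (MvPolynomial.X 2 : ProjAffPoly K 2 2) := MvPolynomial.X_prime
  have hnd : ¬ (MvPolynomial.X 2 : ProjAffPoly K 2 2) ∣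
      cubicForm (MvPolynomial.X 0) (MvPolynomial.X 1) := by
    rintro ⟨c, hc⟩
    -- On `Z = 0` the cubic form is `(u + v - 1)XY(X + Y)`, which is 2 at this point.
    have := congrArg (fun F => affineValue F ![1, 1, (0 : K)] ![1, 1]) hc
    simp only [affineValue_cubicForm, affineValue_mul] at this
    simp [cubicValue, affineValue] at this
  rw [map_mul, ofDoubleCover_doubleCover] at h
  obtain ⟨r, hr⟩ := hprime.pow_dvd_of_dvd_mul_left N hnd
    (b := -4 * MvPolynomial.X 2 * ofDoubleCover K q) ⟨G, by rw [← h]; ring⟩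
  have hGr : G = cubicForm (MvPolynomial.X 0) (MvPolynomial.X 1) * r := by
    refine mul_left_cancel₀ (pow_ne_zero N hprime.ne_zero) ?_
    rw [← h]
    linear_combination cubicForm (MvPolynomial.X 0) (MvPolynomial.X 1) * hr
  rw [mem_cubicThreefold_iff] at hp
  rw [hGr, valueAt_eq_affineValue, affineValue_mul, affineValue_cubicForm, hp, zero_mul] at hGp
  exact hGp rfl

theorem isIrreducible_cubicThreefold [Algebra ℚ K] [CharZero K] :
    @IsIrreducible _ (zariski K K 2 2) (cubicThreefold K) := by
  refine isIrreducible_zariski ?_ ?_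
  · have h0 : (![1, 0, 0] : Fin 3 → K) ≠ 0 := fun h => by
      have := congrFun h 0
      simp at this
    exact ⟨(Projectivization.mk K _ h0, ![0, 0]), (mk_mem_cubicThreefold_iff h0 _).2
      (by simp [cubicValue])⟩
  · intro d e F G hF hG hpF hpG
    obtain ⟨N, H, hH, hFH⟩ := exists_not_doubleCover_dvd hpF
    obtain ⟨N', H', hH', hGH⟩ := exists_not_doubleCover_dvd hpG
    obtain ⟨y, w, hy, hyw, h1, h2⟩ := exists_rational_point hFH hGH
    have hy2 : (y 2 : K) ≠ 0 := by simpa using hy 2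
    -- The preimage of `(y, w)` under the plane coordinates; it exists because `y₂ ≠ 0`.
    let x : Fin 3 → K := ![(w - symOne (fun i => (y i : K))) / 2,
      (-w - symOne (fun i => (y i : K))) / 2, y 2]
    let a : Fin 2 → K := ![-(y 0 / y 2), -(y 1 / y 2)]
    have hx : x ≠ 0 := fun h => hy2 (by simpa [x] using congrFun h 2)
    have hpl : planeCoordinates (a 0) (a 1) (x 0) (x 1) (x 2) = fun i => (y i : K) := by
      funext i
      fin_cases i
      · simp [planeCoordinates, a, x, hy2]
      · simp [planeCoordinates, a, x, hy2]
      · simp [planeCoordinates, a, x]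
      · simp [planeCoordinates, a, x, symOne]
        field_simp
        ring
    have hw : x 0 - x 1 = w := by
      simp [x]
      ring
    refine ⟨(Projectivization.mk K x hx, a), ?_, ?_, ?_⟩
    · rw [mk_mem_cubicThreefold_iff]
      have h := doubleCover_planeCoordinates (a 0) (a 1) (x 0) (x 1) (x 2)
      rw [hpl, hw, hyw, sub_self] at h
      simpa [x, hy] using h.symm
    · rw [valueAt_mk_ne_zero_iff hx a hF]
      intro h0
      rw [← hpl, ← hw, ← affineValue_ofDoubleCover, hH, affineValue_mul, h0, mul_zero] at h1
      exact h1 rfl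
    · rw [valueAt_mk_ne_zero_iff hx a hG]
      intro h0
      rw [← hpl, ← hw, ← affineValue_ofDoubleCover, hH', affineValue_mul, h0, mul_zero] at h2
      exact h2 rfl

end CubicThreefold

end

noncomputable section

/-! ### The birational morphism and its inverse on `x₅ ≠ 0`. -/

section Birational

variable {K : Type*} [Field K]

theorem mk_congr {n : ℕ} {x y : Fin (n + 1) → K} (h : x = y) (hx : x ≠ 0) (hy : y ≠ 0) :
    Projectivization.mk K x hx = Projectivization.mk K y hy := by
  subst h
  rfl

theorem fst_mapToBurkhardt (p : ProjAff K 2 2) :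
    (mapToBurkhardt p).1 = Projectivization.mk K (planeEmbedding (p.2 0) (p.2 1) p.1.rep)
      ((planeEmbedding_injective _ _).ne_iff' (map_zero _) |>.2 p.1.rep_nonzero) := by
  conv_lhs => rw [mapToBurkhardt, ← p.1.mk_rep]
  rfl

theorem mapToBurkhardt_eq (p : ProjAff K 2 2) (a : Fin 0 → K) :
    mapToBurkhardt p = (Projectivization.mk K (planeEmbedding (p.2 0) (p.2 1) p.1.rep)
      ((planeEmbedding_injective _ _).ne_iff' (map_zero _) |>.2 p.1.rep_nonzero), a) :=
  Prod.ext (fst_mapToBurkhardt p) (Subsingleton.elim _ _)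

theorem mapsTo_mapToBurkhardt [Algebra ℚ K] [CharZero K] :
    Set.MapsTo mapToBurkhardt (cubicThreefold K) (symmetricBurkhardt K) := by
  intro p hp
  rw [mem_cubicThreefold_iff] at hp
  rw [mapToBurkhardt_eq p ![], mk_mem_symmetricBurkhardt_iff]
  exact ⟨sum_planeEmbedding _ _ _, by rw [esymm_four_planeEmbedding, hp, mul_zero]⟩

theorem isRegularOver_mapToBurkhardt {k : Type*} [Field k] [Algebra k K]
    (U : Set (ProjAff K 2 2)) : IsRegularOver k U (mapToBurkhardt (K := K)) := by
  intro p _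
  let u : ProjAffPoly k 2 2 := MvPolynomial.C (MvPolynomial.X 0)
  let v : ProjAffPoly k 2 2 := MvPolynomial.C (MvPolynomial.X 1)
  let P : Fin 6 → ProjAffPoly k 2 2 := ![MvPolynomial.X 0, MvPolynomial.X 1,
    -u * MvPolynomial.X 2, -v * MvPolynomial.X 2, MvPolynomial.X 2,
    -MvPolynomial.X 0 - MvPolynomial.X 1 + (u + v - 1) * MvPolynomial.X 2]
  have hP : ∀ q : ProjAff K 2 2, (fun i => valueAt (P i) q)
      = planeEmbedding (q.2 0) (q.2 1) q.1.rep := by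
    intro q
    funext i
    fin_cases i <;> simp [P, u, v, valueAt, planeEmbedding, MvPolynomial.eval₂_mul,
      MvPolynomial.eval₂_neg, MvPolynomial.eval₂_sub]
  have hX : ∀ i : Fin 3, (MvPolynomial.X i : ProjAffPoly k 2 2).IsHomogeneous 1 :=
    MvPolynomial.isHomogeneous_X _
  have hC : ∀ r : MvPolynomial (Fin 2) k,
      (MvPolynomial.C r * MvPolynomial.X 2 : ProjAffPoly k 2 2).IsHomogeneous 1 := fun r => by
    simpa using (MvPolynomial.isHomogeneous_C (Fin 3) r).mul (hX 2)
  refine ⟨1, 0, P, Fin.elim0, 1, ?_, fun j => j.elim0, MvPolynomial.isHomogeneous_one _ _, ?_, ?_,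
    fun q _ _ h => ⟨?_, fun j => j.elim0⟩⟩
  · intro i
    fin_cases i
    · exact hX 0
    · exact hX 1
    · simpa [P, u] using hC (-MvPolynomial.X 0)
    · simpa [P, v] using hC (-MvPolynomial.X 1)
    · exact hX 2
    · have := ((hX 0).neg.sub (hX 1)).add (hC (MvPolynomial.X 0 + MvPolynomial.X 1 - 1))
      simpa [P, u, v] using this
  · simp [valueAt]
  · rw [hP]
    exact (planeEmbedding_injective _ _).ne_iff' (map_zero _) |>.2 p.1.rep_nonzero
  · simp only [fst_mapToBurkhardt, hP]

open Classical in
/-- The inverse of `mapToBurkhardt` on `x₅ ≠ 0`. -/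
def mapFromBurkhardt (p : ProjAff K 5 0) : ProjAff K 2 2 :=
  if h : (![p.1.rep 0, p.1.rep 1, p.1.rep 4] : Fin 3 → K) ≠ 0 then
    (Projectivization.mk K _ h, ![-(p.1.rep 2 / p.1.rep 4), -(p.1.rep 3 / p.1.rep 4)])
  else
    -- An arbitrary value; this branch never occurs where `x₅ ≠ 0`.
    (Projectivization.mk K ![1, 0, 0] (fun h => one_ne_zero (congrFun h 0)), 0)

theorem mapFromBurkhardt_mk {x : Fin 6 → K} (hx : x ≠ 0) (h4 : x 4 ≠ 0) (a : Fin 0 → K) :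
    mapFromBurkhardt (Projectivization.mk K x hx, a)
      = (Projectivization.mk K ![x 0, x 1, x 4] (fun h => h4 (congrFun h 2)),
        ![-(x 2 / x 4), -(x 3 / x 4)]) := by
  obtain ⟨c, hc⟩ := Projectivization.exists_smul_eq_mk_rep K x hx
  have hr : ∀ i, (Projectivization.mk K x hx).rep i = c * x i := fun i => by
    rw [← hc]; rfl
  have h : (![(Projectivization.mk K x hx).rep 0, (Projectivization.mk K x hx).rep 1,
      (Projectivization.mk K x hx).rep 4] : Fin 3 → K) ≠ 0 := fun h =>
    mul_ne_zero c.ne_zero h4 ((hr 4).symm.trans (congrFun h 2))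
  rw [mapFromBurkhardt, dif_pos h]
  refine Prod.ext ?_ ?_
  · refine (Projectivization.mk_eq_mk_iff' K _ _ _ _).2 ⟨c, ?_⟩
    simp [Matrix.smul_cons, hr]
  · simp [hr, mul_div_mul_left _ _ c.ne_zero]

theorem valueAt_X {k : Type*} [Field k] [Algebra k K] {n m : ℕ} (i : Fin (n + 1))
    (p : ProjAff K n m) :
    valueAt (MvPolynomial.X i : ProjAffPoly k n m) p = p.1.rep i := by
  simp [valueAt]

theorem isRegularOver_mapFromBurkhardt {k : Type*} [Field k] [Algebra k K]
    {V : Set (ProjAff K 5 0)} (hV : ∀ p ∈ V, p.1.rep 4 ≠ 0) :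
    IsRegularOver k V (mapFromBurkhardt (K := K)) := by
  have hX : ∀ i : Fin 6, (MvPolynomial.X i : ProjAffPoly k 5 0).IsHomogeneous 1 :=
    MvPolynomial.isHomogeneous_X _
  have hP : ∀ q : ProjAff K 5 0, (fun i => valueAt ((![MvPolynomial.X 0, MvPolynomial.X 1,
      MvPolynomial.X 4] : Fin 3 → ProjAffPoly k 5 0) i) q)
      = ![q.1.rep 0, q.1.rep 1, q.1.rep 4] := by
    intro q
    funext i
    fin_cases i <;> simp [valueAt_X]
  intro p hp
  refine ⟨1, 1, ![MvPolynomial.X 0, MvPolynomial.X 1, MvPolynomial.X 4],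
    ![-MvPolynomial.X 2, -MvPolynomial.X 3], MvPolynomial.X 4, ?_, ?_, hX 4, ?_, ?_, ?_⟩
  · intro i
    fin_cases i
    exacts [hX 0, hX 1, hX 4]
  · intro i
    fin_cases i
    exacts [(hX 2).neg, (hX 3).neg]
  · rw [valueAt_X]
    exact hV p hp
  · rw [hP]
    exact fun h => hV p hp (congrFun h 2)
  · intro q hq _ h
    rw [hP] at h
    simp only [hP]
    rw [mapFromBurkhardt, dif_pos h]
    refine ⟨rfl, fun j => ?_⟩
    fin_cases j <;> simp [valueAt, MvPolynomial.eval₂_neg, neg_div]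

theorem mapFromBurkhardt_mapToBurkhardt {p : ProjAff K 2 2} (hp : p.1.rep 2 ≠ 0) :
    mapFromBurkhardt (mapToBurkhardt p) = p := by
  rw [mapToBurkhardt_eq p ![], mapFromBurkhardt_mk _ (by simpa [planeEmbedding] using hp)]
  refine Prod.ext ?_ ?_
  · conv_rhs => rw [← p.1.mk_rep]
    refine mk_congr (funext fun i => ?_) _ _
    fin_cases i <;> simp [planeEmbedding]
  · funext i
    fin_cases i
    · simp [planeEmbedding]; field_simp
    · simp [planeEmbedding]; field_simp

theorem mapToBurkhardt_mk {x : Fin 3 → K} (hx : x ≠ 0) (a : Fin 2 → K) (b : Fin 0 → K) :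
    mapToBurkhardt (Projectivization.mk K x hx, a)
      = (Projectivization.mk K (planeEmbedding (a 0) (a 1) x)
        ((planeEmbedding_injective _ _).ne_iff' (map_zero _) |>.2 hx), b) :=
  Prod.ext rfl (Subsingleton.elim _ _)

theorem exists_rep_eq_planeEmbedding {p : ProjAff K 5 0} (hsum : ∑ i, p.1.rep i = 0)
    (h4 : p.1.rep 4 ≠ 0) :
    planeEmbedding (-(p.1.rep 2 / p.1.rep 4)) (-(p.1.rep 3 / p.1.rep 4))
      ![p.1.rep 0, p.1.rep 1, p.1.rep 4] = p.1.rep := by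
  have hsum := (Fin.sum_univ_six p.1.rep).symm.trans hsum
  funext i
  fin_cases i <;> simp [planeEmbedding, h4]
  field_simp
  linear_combination -hsum

theorem mapFromBurkhardt_eq {p : ProjAff K 5 0} (h4 : p.1.rep 4 ≠ 0) :
    mapFromBurkhardt p
      = (Projectivization.mk K ![p.1.rep 0, p.1.rep 1, p.1.rep 4] (fun h => h4 (congrFun h 2)),
        ![-(p.1.rep 2 / p.1.rep 4), -(p.1.rep 3 / p.1.rep 4)]) := by
  rw [mapFromBurkhardt, dif_pos]

theorem mapToBurkhardt_mapFromBurkhardt {p : ProjAff K 5 0} (hsum : ∑ i, p.1.rep i = 0)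
    (h4 : p.1.rep 4 ≠ 0) : mapToBurkhardt (mapFromBurkhardt p) = p := by
  rw [mapFromBurkhardt_eq h4, mapToBurkhardt_mk _ _ p.2]
  refine Prod.ext ?_ rfl
  conv_rhs => rw [← p.1.mk_rep]
  exact mk_congr (exists_rep_eq_planeEmbedding hsum h4) _ _

theorem rep_mk_ne_zero_iff {n : ℕ} {x : Fin (n + 1) → K} (hx : x ≠ 0) (i : Fin (n + 1)) :
    (Projectivization.mk K x hx).rep i ≠ 0 ↔ x i ≠ 0 := by
  obtain ⟨c, hc⟩ := Projectivization.exists_smul_eq_mk_rep K x hx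
  rw [← hc]
  simp [Units.smul_def]

theorem isBirationalMorphism_mapToBurkhardt [Algebra ℚ K] [CharZero K] :
    IsBirationalMorphism ℚ (cubicThreefold K) (symmetricBurkhardt K) mapToBurkhardt where
  irreducible_source := isIrreducible_cubicThreefold
  irreducible_target := isIrreducible_symmetricBurkhardt
  regular := isRegularOver_mapToBurkhardt _
  mapsTo := mapsTo_mapToBurkhardt
  exists_inverse := by
    have hto : Set.MapsTo mapToBurkhardt
        (cubicThreefold K ∩ {p | valueAt (MvPolynomial.X 2 : ProjAffPoly ℚ 2 2) p ≠ 0})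
        (symmetricBurkhardt K ∩ {p | valueAt (MvPolynomial.X 4 : ProjAffPoly ℚ 5 0) p ≠ 0}) := by
      rintro p ⟨hp, hp2⟩
      refine ⟨mapsTo_mapToBurkhardt hp, ?_⟩
      rw [Set.mem_ofPred_eq, valueAt_X] at hp2 ⊢
      rw [fst_mapToBurkhardt, rep_mk_ne_zero_iff]
      simpa [planeEmbedding] using hp2
    have hfrom : Set.MapsTo mapFromBurkhardt
        (symmetricBurkhardt K ∩ {p | valueAt (MvPolynomial.X 4 : ProjAffPoly ℚ 5 0) p ≠ 0})
        (cubicThreefold K ∩ {p | valueAt (MvPolynomial.X 2 : ProjAffPoly ℚ 2 2) p ≠ 0}) := by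
      rintro p ⟨hp, hp4⟩
      rw [Set.mem_ofPred_eq, valueAt_X] at hp4
      rw [mem_symmetricBurkhardt_iff] at hp
      rw [mapFromBurkhardt_eq hp4]
      refine ⟨?_, ?_⟩
      · rw [mk_mem_cubicThreefold_iff]
        have h := hp.2
        rw [← exists_rep_eq_planeEmbedding hp.1 hp4, esymm_four_planeEmbedding] at h
        exact (mul_eq_zero.1 h).resolve_left hp4
      · rw [Set.mem_ofPred_eq, valueAt_X, rep_mk_ne_zero_iff]
        exact hp4
    obtain ⟨p, hp, hp4⟩ := symmetricBurkhardt_nonempty (K := K)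
    have hp4' : valueAt (MvPolynomial.X 4 : ProjAffPoly ℚ 5 0) p ≠ 0 := by rwa [valueAt_X]
    refine ⟨_, _, mapFromBurkhardt,
      TopologicalSpace.isOpen_generateFrom_of_mem
        ⟨1, MvPolynomial.X 2, MvPolynomial.isHomogeneous_X _ _, rfl⟩, ?_,
      TopologicalSpace.isOpen_generateFrom_of_mem
        ⟨1, MvPolynomial.X 4, MvPolynomial.isHomogeneous_X _ _, rfl⟩, ?_,
      isRegularOver_mapFromBurkhardt fun p hp => by simpa [valueAt_X] using hp.2,
      hto, hfrom, ?_, ?_⟩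
    · have h := subset_closure_inter_of_isIrreducible (isIrreducible_cubicThreefold (K := K))
        (MvPolynomial.isHomogeneous_X _ 2) ⟨_, (hfrom ⟨hp, hp4'⟩).1, by
          have := (hfrom ⟨hp, hp4'⟩).2
          rw [Set.mem_ofPred_eq, valueAt_X] at this
          rwa [valueAt_X]⟩
      simpa only [valueAt_X] using h
    · have h := subset_closure_inter_of_isIrreducible (isIrreducible_symmetricBurkhardt (K := K))
        (MvPolynomial.isHomogeneous_X _ 4) ⟨p, hp, by rwa [valueAt_X]⟩
      simpa only [valueAt_X] using h
    · rintro p ⟨_, hp⟩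
      exact mapFromBurkhardt_mapToBurkhardt (by simpa [valueAt_X] using hp)
    · rintro p ⟨hp, hp4⟩
      exact mapToBurkhardt_mapFromBurkhardt ((mem_symmetricBurkhardt_iff p).1 hp).1
        (by simpa [valueAt_X] using hp4)

end Birational

end

noncomputable section

/-! ### Smoothness and flexes of the plane cubics. -/

section PlaneCubic

section CommRing

variable {R : Type*} [CommRing R]

/-- The coefficient `α` of the flex tangents `aX + αZ`, `aY + αZ`, `a(X + Y) - (a² + α)Z`, where
`a = u + v - 1`. -/
def flexCoeff (u v : R) : R := u + v - u * v

/-- The coefficient `c` in `a²F = (aX + αZ)(aY + αZ)(a(X + Y) - (a² + α)Z) + cZ³`. -/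
def cubeCoeff (u v : R) : R :=
  (u + v - 1) ^ 3 * (u * v) + (u + v - 1) ^ 2 * flexCoeff u v ^ 2 + flexCoeff u v ^ 3

/-- The product of the irreducible factors of the discriminant. -/
def cubicDiscriminant (u v : R) : R :=
  (u + v - 1) * cubeCoeff u v *
    (27 * cubeCoeff u v - (3 * flexCoeff u v + (u + v - 1) ^ 2) ^ 3)

theorem cubicDiscriminant_map {S : Type*} [CommRing S] (f : R →+* S) (u v : R) :
    f (cubicDiscriminant u v) = cubicDiscriminant (f u) (f v) := by
  simp only [cubicDiscriminant, cubeCoeff, flexCoeff, map_add, map_sub, map_mul, map_pow, map_one,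
    map_ofNat]

/-- This puts the cubic in the pencil of three lines and the triple line `Z³`. Along each of the
three lines only the term in `Z³` survives, which makes its intersection with `Z = 0` a flex. -/
theorem sq_mul_cubicValue (u v X Y Z : R) :
    (u + v - 1) ^ 2 * cubicValue u v X Y Z
      = ((u + v - 1) * X + flexCoeff u v * Z) * ((u + v - 1) * Y + flexCoeff u v * Z)
        * ((u + v - 1) * (X + Y) - ((u + v - 1) ^ 2 + flexCoeff u v) * Z)
        + cubeCoeff u v * Z ^ 3 := by
  simp only [cubicValue, flexCoeff, cubeCoeff]
  ring

/-- The partial derivatives of the cubic form. -/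
def cubicGradient (u v X Y Z : R) : Fin 3 → R :=
  ![(u + v - 1) * (2 * X * Y + Y ^ 2) + 2 * (-(u * v) + u + v) * (X * Z)
      + (-u ^ 2 - 3 * u * v + 3 * u - v ^ 2 + 3 * v - 1) * (Y * Z)
      + (u ^ 2 * v - u ^ 2 + u * v ^ 2 - 3 * u * v + u - v ^ 2 + v) * Z ^ 2,
    (u + v - 1) * (2 * X * Y + X ^ 2) + 2 * (-(u * v) + u + v) * (Y * Z)
      + (-u ^ 2 - 3 * u * v + 3 * u - v ^ 2 + 3 * v - 1) * (X * Z)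
      + (u ^ 2 * v - u ^ 2 + u * v ^ 2 - 3 * u * v + u - v ^ 2 + v) * Z ^ 2,
    (-(u * v) + u + v) * (X ^ 2 + Y ^ 2)
      + (-u ^ 2 - 3 * u * v + 3 * u - v ^ 2 + 3 * v - 1) * (X * Y)
      + 3 * (u ^ 2 * v + u * v ^ 2 - u * v) * Z ^ 2
      + 2 * (u ^ 2 * v - u ^ 2 + u * v ^ 2 - 3 * u * v + u - v ^ 2 + v) * ((X + Y) * Z)]

theorem pderiv_cubicForm (u v : R) (i : Fin 3) :
    MvPolynomial.pderiv i (cubicForm u v)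
      = cubicGradient (MvPolynomial.C u) (MvPolynomial.C v) (MvPolynomial.X 0)
          (MvPolynomial.X 1) (MvPolynomial.X 2) i := by
  fin_cases i
  all_goals
    simp [cubicForm, cubicGradient, MvPolynomial.pderiv_X, Derivation.leibniz,
      Derivation.leibniz_pow]
    rw [map_ofNat (MvPolynomial.C (R := R) (σ := Fin 3)) 3]
    ring

theorem cubicGradient_map {S : Type*} [CommRing S] (f : R →+* S) (u v X Y Z : R) (i : Fin 3) :
    f (cubicGradient u v X Y Z i) = cubicGradient (f u) (f v) (f X) (f Y) (f Z) i := by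
  fin_cases i <;> simp [cubicGradient, map_ofNat f 2, map_ofNat f 3]

theorem aeval_pderiv_cubicForm {S : Type*} [CommRing S] [Algebra R S] (u v : R) (x : Fin 3 → S)
    (i : Fin 3) :
    MvPolynomial.aeval x (MvPolynomial.pderiv i (cubicForm u v))
      = cubicGradient (algebraMap R S u) (algebraMap R S v) (x 0) (x 1) (x 2) i := by
  rw [pderiv_cubicForm]
  change (MvPolynomial.aeval x : MvPolynomial (Fin 3) R →ₐ[R] S).toRingHom _ = _
  rw [cubicGradient_map]
  simp

theorem aeval_cubicForm {S : Type*} [CommRing S] [Algebra R S] (u v : R) (x : Fin 3 → S) :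
    MvPolynomial.aeval x (cubicForm u v)
      = cubicValue (algebraMap R S u) (algebraMap R S v) (x 0) (x 1) (x 2) := by
  rw [cubicForm_eq_cubicValue]
  change (MvPolynomial.aeval x : MvPolynomial (Fin 3) R →ₐ[R] S).toRingHom _ = _
  rw [cubicValue_map]
  simp

end CommRing

variable {L : Type*} [Field L]

/-- Let `p, q, r` be the three linear factors, so that `pqr + cZ³ = 0` and `p + q - r = (3α + a²)Z`.
At a singular point with `Z ≠ 0`, `c ≠ 0` forces `pqr ≠ 0`. The derivatives in `X` and `Y` then give
`p = q = -r`, whence `27c = (3α + a²)³`, which is excluded. If `Z = 0`, the derivatives in `X` and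
`Y` show that `XY(X + Y)` would have a multiple root. -/
theorem eq_zero_of_cubicGradient_eq_zero {u v X Y Z : L} (hD : cubicDiscriminant u v ≠ 0)
    (hF : cubicValue u v X Y Z = 0) (hG : ∀ i, cubicGradient u v X Y Z i = 0) :
    X = 0 ∧ Y = 0 ∧ Z = 0 := by
  rw [cubicDiscriminant, mul_ne_zero_iff, mul_ne_zero_iff] at hD
  obtain ⟨⟨ha, hc⟩, hP⟩ := hD
  have e0 := sq_mul_cubicValue u v X Y Z
  rw [hF, mul_zero] at e0
  obtain ⟨p, hp⟩ : ∃ p, p = (u + v - 1) * X + flexCoeff u v * Z := ⟨_, rfl⟩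
  obtain ⟨q, hq⟩ : ∃ q, q = (u + v - 1) * Y + flexCoeff u v * Z := ⟨_, rfl⟩
  obtain ⟨r, hr⟩ : ∃ r, r = (u + v - 1) * (X + Y) - ((u + v - 1) ^ 2 + flexCoeff u v) * Z :=
    ⟨_, rfl⟩
  have eX : (u + v - 1) * (q * (r + p)) = 0 := by
    have := hG 0
    simp only [cubicGradient, Matrix.cons_val] at this
    rw [hp, hq, hr, flexCoeff]
    linear_combination (u + v - 1) ^ 2 * this
  have eY : (u + v - 1) * (p * (r + q)) = 0 := by
    have := hG 1
    simp only [cubicGradient, Matrix.cons_val] at this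
    rw [hp, hq, hr, flexCoeff]
    linear_combination (u + v - 1) ^ 2 * this
  rw [← hp, ← hq, ← hr] at e0
  have eX' := (mul_eq_zero.1 eX).resolve_left ha
  have eY' := (mul_eq_zero.1 eY).resolve_left ha
  have hsum : p + q - r = (3 * flexCoeff u v + (u + v - 1) ^ 2) * Z := by
    rw [hp, hq, hr]; ring
  have hZ : Z = 0 := by
    by_contra hZ
    have hpqr : p * q * r ≠ 0 := fun h => by
      rw [h, zero_add] at e0
      exact mul_ne_zero hc (pow_ne_zero 3 hZ) e0.symm
    rw [mul_ne_zero_iff, mul_ne_zero_iff] at hpqr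
    obtain ⟨⟨hp0, hq0⟩, -⟩ := hpqr
    have h1 := (mul_eq_zero.1 eX').resolve_left hq0
    have h2 := (mul_eq_zero.1 eY').resolve_left hp0
    have hrp : r = -p := by linear_combination h1
    have hqp : q = p := by linear_combination h2 - h1
    rw [hrp, hqp] at e0 hsum
    have h3 : p * 3 = (3 * flexCoeff u v + (u + v - 1) ^ 2) * Z := by linear_combination hsum
    have h4 := congrArg (fun z => z ^ 3) h3
    refine mul_ne_zero hP (pow_ne_zero 3 hZ) ?_
    linear_combination h4 - 27 * e0
  subst hZ
  have hpX : p = (u + v - 1) * X := by rw [hp]; ring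
  have hqY : q = (u + v - 1) * Y := by rw [hq]; ring
  have hrXY : r = (u + v - 1) * (X + Y) := by rw [hr]; ring
  rw [hpX, hqY, hrXY] at eX' eY'
  have f1 : Y * (2 * X + Y) = 0 := by
    refine (mul_eq_zero.1 ?_).resolve_left (pow_ne_zero 2 ha)
    linear_combination eX'
  have f2 : X * (X + 2 * Y) = 0 := by
    refine (mul_eq_zero.1 ?_).resolve_left (pow_ne_zero 2 ha)
    linear_combination eY'
  have f3 : X * Y * (X + Y) = 0 := by
    refine (mul_eq_zero.1 ?_).resolve_left (pow_ne_zero 3 ha)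
    rw [hpX, hqY, hrXY] at e0
    linear_combination -e0
  have hXY : X = 0 ∧ Y = 0 := by
    rcases mul_eq_zero.1 f3 with h | h
    · rcases mul_eq_zero.1 h with h | h
      · subst h; simpa using f1
      · subst h; simpa using f2
    · have : Y = -X := by linear_combination h
      subst this
      have : X = 0 := by
        have : X ^ 2 = 0 := by linear_combination -f2
        exact pow_eq_zero_iff two_ne_zero |>.1 this
      simp [this]
  exact ⟨hXY.1, hXY.2, rfl⟩

theorem isSmoothPlaneCurve_cubicForm {u v : L} (hD : cubicDiscriminant u v ≠ 0) :
    IsSmoothPlaneCurve (cubicForm u v) := by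
  intro x hx hF
  by_contra! hG
  simp only [aeval_pderiv_cubicForm] at hG
  rw [aeval_cubicForm] at hF
  have hD' : cubicDiscriminant (algebraMap L (AlgebraicClosure L) u)
      (algebraMap L (AlgebraicClosure L) v) ≠ 0 := by
    rw [← cubicDiscriminant_map]
    exact (map_ne_zero _).2 hD
  obtain ⟨h0, h1, h2⟩ := eq_zero_of_cubicGradient_eq_zero hD' hF hG
  refine hx (funext fun i => ?_)
  fin_cases i
  exacts [h0, h1, h2]

theorem isSmoothPlaneCurve_genericFibre :
    IsSmoothPlaneCurve
      (cubicForm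
        (algebraMap (MvPolynomial (Fin 2) ℚ) (FractionRing (MvPolynomial (Fin 2) ℚ))
          (MvPolynomial.X 0))
        (algebraMap (MvPolynomial (Fin 2) ℚ) (FractionRing (MvPolynomial (Fin 2) ℚ))
          (MvPolynomial.X 1))) := by
  apply isSmoothPlaneCurve_cubicForm
  rw [← cubicDiscriminant_map, Ne, IsFractionRing.to_map_eq_zero_iff]
  intro h
  -- At `u = v = 2` one has `a = 3`, `α = 0`, `c = 108`, and no factor of the discriminant vanishes.
  have := congrArg (MvPolynomial.eval ![(2 : ℚ), 2]) h
  rw [cubicDiscriminant_map] at this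
  simp [cubicDiscriminant, cubeCoeff, flexCoeff] at this
  norm_num at this

theorem exists_cubicGradient_ne_zero {u v : L} (h : IsSmoothPlaneCurve (cubicForm u v))
    {X Y Z : L} (hx : ![X, Y, Z] ≠ 0) (hF : cubicValue u v X Y Z = 0) :
    ∃ i, cubicGradient u v X Y Z i ≠ 0 := by
  let φ := algebraMap L (AlgebraicClosure L)
  have hx' : (![φ X, φ Y, φ Z] : Fin 3 → AlgebraicClosure L) ≠ 0 := fun h0 => hx (by
    have h1 : φ X = 0 := congrFun h0 0
    have h2 : φ Y = 0 := congrFun h0 1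
    have h3 : φ Z = 0 := congrFun h0 2
    rw [map_eq_zero] at h1 h2 h3
    simp [h1, h2, h3])
  obtain ⟨i, hi⟩ := h _ hx' (by
    rw [aeval_cubicForm]
    simp only [Matrix.cons_val]
    rw [← cubicValue_map, hF, map_zero])
  refine ⟨i, fun h0 => hi ?_⟩
  rw [aeval_pderiv_cubicForm]
  simp only [Matrix.cons_val]
  rw [← cubicGradient_map, h0, map_zero]

/-- For `u + v = 1` the point `(0:0:1)` is singular. -/
theorem add_sub_one_ne_zero_of_isSmoothPlaneCurve {u v : L}
    (h : IsSmoothPlaneCurve (cubicForm u v)) : u + v - 1 ≠ 0 := by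
  intro ha
  have hv : v = 1 - u := by linear_combination ha
  subst hv
  obtain ⟨i, hi⟩ := exists_cubicGradient_ne_zero h (X := 0) (Y := 0) (Z := 1)
    (fun h0 => one_ne_zero (congrFun h0 2)) (by simp [cubicValue]; ring)
  refine hi ?_
  fin_cases i
  · simp [cubicGradient]; ring
  · simp [cubicGradient]; ring
  · simp [cubicGradient]; exact Or.inr (by ring)

/-- For `c = 0` the cubic splits into three lines, and the intersection `(-α:-α:a)` of the first two
is singular. -/
theorem cubeCoeff_ne_zero_of_isSmoothPlaneCurve {u v : L}
    (h : IsSmoothPlaneCurve (cubicForm u v)) : cubeCoeff u v ≠ 0 := by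
  intro hc
  have ha := add_sub_one_ne_zero_of_isSmoothPlaneCurve h
  obtain ⟨i, hi⟩ := exists_cubicGradient_ne_zero h (X := -flexCoeff u v) (Y := -flexCoeff u v)
    (Z := u + v - 1) (fun h0 => ha (congrFun h0 2)) (by
      refine (mul_eq_zero.1 ?_).resolve_left (pow_ne_zero 2 ha)
      rw [sq_mul_cubicValue, hc]
      ring)
  refine hi ?_
  fin_cases i
  · simp [cubicGradient, flexCoeff]; ring
  · simp [cubicGradient, flexCoeff]; ring
  · simp only [cubeCoeff, flexCoeff] at hc
    simp [cubicGradient, flexCoeff]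
    linear_combination 3 * hc

/-- The hypothesis `hline` says that the product of the three linear forms vanishes along `x + ty`.
There `Z = at`, so the cubic restricts to `ac t³`, with `ac ≠ 0` by smoothness. -/
theorem isFlex_cubicForm {u v : L} (h : IsSmoothPlaneCurve (cubicForm u v)) {x y : Fin 3 → L}
    (hx2 : x 2 = 0) (hy2 : y 2 = u + v - 1) (hx : x ≠ 0)
    (hF : x 0 * x 1 * (x 0 + x 1) = 0)
    (hline : ∀ t : Polynomial L,
      (Polynomial.C (u + v - 1) * (Polynomial.C (x 0) + t * Polynomial.C (y 0))
          + Polynomial.C (flexCoeff u v) * (t * Polynomial.C (u + v - 1)))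
        * (Polynomial.C (u + v - 1) * (Polynomial.C (x 1) + t * Polynomial.C (y 1))
          + Polynomial.C (flexCoeff u v) * (t * Polynomial.C (u + v - 1)))
        * (Polynomial.C (u + v - 1) * (Polynomial.C (x 0) + t * Polynomial.C (y 0)
            + (Polynomial.C (x 1) + t * Polynomial.C (y 1)))
          - Polynomial.C ((u + v - 1) ^ 2 + flexCoeff u v)
            * (t * Polynomial.C (u + v - 1))) = 0) :
    IsFlex (cubicForm u v) x := by
  have ha := add_sub_one_ne_zero_of_isSmoothPlaneCurve h
  have hc := cubeCoeff_ne_zero_of_isSmoothPlaneCurve h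
  have hval : cubicValue u v (x 0) (x 1) 0 = 0 := by
    simp only [cubicValue]
    linear_combination (u + v - 1) * hF
  have hx' : x = ![x 0, x 1, 0] := by
    funext i
    fin_cases i
    exacts [rfl, rfl, hx2]
  refine ⟨?_, ?_, y, ?_, ?_⟩
  · rw [← MvPolynomial.coe_aeval_eq_eval]
    change MvPolynomial.aeval x _ = 0
    rw [aeval_cubicForm, hx2]
    exact hval
  · obtain ⟨i, hi⟩ := exists_cubicGradient_ne_zero h (hx' ▸ hx) hval
    refine ⟨i, ?_⟩
    rw [← MvPolynomial.coe_aeval_eq_eval]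
    change MvPolynomial.aeval x _ ≠ 0
    rw [aeval_pderiv_cubicForm, hx2]
    exact hi
  · rw [LinearIndependent.pair_iff]
    intro s t hst
    have h2 := congrFun hst 2
    simp only [Pi.add_apply, Pi.smul_apply, hx2, hy2, smul_eq_mul, mul_zero, zero_add,
      Pi.zero_apply] at h2
    have ht := (mul_eq_zero.1 h2).resolve_right ha
    rw [ht, zero_smul, add_zero] at hst
    exact ⟨(smul_eq_zero.1 hst).resolve_right hx, ht⟩
  · have hpoly : (MvPolynomial.aeval
        (fun i => Polynomial.C (x i) + Polynomial.X * Polynomial.C (y i)) (cubicForm u v) :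
        Polynomial L) = Polynomial.C ((u + v - 1) * cubeCoeff u v) * Polynomial.X ^ 3 := by
      have h2 : (Polynomial.C (u + v - 1) : Polynomial L) ^ 2 ≠ 0 := by
        rw [← Polynomial.C_pow]
        exact Polynomial.C_ne_zero.2 (pow_ne_zero 2 ha)
      refine mul_left_cancel₀ h2 ?_
      rw [aeval_cubicForm, Polynomial.algebraMap_eq]
      have hid := sq_mul_cubicValue (Polynomial.C u) (Polynomial.C v)
        (Polynomial.C (x 0) + Polynomial.X * Polynomial.C (y 0))
        (Polynomial.C (x 1) + Polynomial.X * Polynomial.C (y 1))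
        (Polynomial.X * Polynomial.C (u + v - 1))
      have hl := hline Polynomial.X
      have hfc : (Polynomial.C (flexCoeff u v) : Polynomial L)
          = flexCoeff (Polynomial.C u) (Polynomial.C v) := by simp [flexCoeff]
      have hcc : (Polynomial.C (cubeCoeff u v) : Polynomial L)
          = cubeCoeff (Polynomial.C u) (Polynomial.C v) := by simp [cubeCoeff, flexCoeff]
      have hac : (Polynomial.C (u + v - 1) : Polynomial L)
          = Polynomial.C u + Polynomial.C v - 1 := by simp
      rw [hx2, hy2, Polynomial.C_0, zero_add, Polynomial.C_mul, hcc]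
      rw [Polynomial.C_add, Polynomial.C_pow, hfc] at hl
      rw [hac] at hid hl ⊢
      linear_combination hid + hl
    rw [hpoly, Polynomial.le_rootMultiplicity_iff (mul_ne_zero
      (Polynomial.C_ne_zero.2 (mul_ne_zero ha hc)) (pow_ne_zero 3 Polynomial.X_ne_zero))]
    simp

theorem isFlex_cubicForm_rational {u v : L} (h : IsSmoothPlaneCurve (cubicForm u v)) :
    IsFlex (cubicForm u v) ![1, 0, 0] ∧ IsFlex (cubicForm u v) ![0, 1, 0] ∧
      IsFlex (cubicForm u v) ![1, -1, 0] := by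
  -- Each `y` is the point with `Z = a` and one more coordinate 0 on the flex tangent: `aY + αZ =
  -- 0`, `aX + αZ = 0` and `a(X + Y) = (a² + α)Z` respectively.
  refine ⟨isFlex_cubicForm h (y := ![0, -flexCoeff u v, u + v - 1]) rfl rfl
      (fun h0 => one_ne_zero (congrFun h0 0)) (by simp) fun t => ?_,
    isFlex_cubicForm h (y := ![-flexCoeff u v, 0, u + v - 1]) rfl rfl
      (fun h0 => one_ne_zero (congrFun h0 1)) (by simp) fun t => ?_,
    isFlex_cubicForm h (y := ![(u + v - 1) ^ 2 + flexCoeff u v, 0, u + v - 1]) rfl rfl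
      (fun h0 => one_ne_zero (congrFun h0 0)) (by simp) fun t => ?_⟩
  · simp only [Matrix.cons_val, map_zero, map_neg, map_one]
    ring
  · simp only [Matrix.cons_val, map_zero, map_neg, map_one]
    ring
  · simp only [Matrix.cons_val, map_zero, map_neg, map_one]
    ring

end PlaneCubic

end

theorem proposition1p4 :
    -- the given map is a birational morphism over `ℚ` of geometrically irreducible varieties
    IsBirationalMorphism ℚ (cubicThreefold (AlgebraicClosure ℚ))
      (symmetricBurkhardt (AlgebraicClosure ℚ)) mapToBurkhardt ∧
    -- the generic fibre over the `(u, v)`-plane is a smooth plane cubic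
    IsSmoothPlaneCurve
      (cubicForm
        (algebraMap (MvPolynomial (Fin 2) ℚ) (FractionRing (MvPolynomial (Fin 2) ℚ))
          (MvPolynomial.X 0))
        (algebraMap (MvPolynomial (Fin 2) ℚ) (FractionRing (MvPolynomial (Fin 2) ℚ))
          (MvPolynomial.X 1))) ∧
    -- the three rational flexes of every smooth fibre (in particular, of the generic one)
    (∀ (L : Type*) [Field L] [Algebra ℚ L] (u v : L), IsSmoothPlaneCurve (cubicForm u v) →
      IsFlex (cubicForm u v) ![1, 0, 0] ∧
      IsFlex (cubicForm u v) ![0, 1, 0] ∧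
      IsFlex (cubicForm u v) ![1, -1, 0]) ∧
    -- the rational points are Zariski-dense
    symmetricBurkhardt (AlgebraicClosure ℚ) ⊆
      closure[zariski (AlgebraicClosure ℚ) (AlgebraicClosure ℚ) 5 0]
        (symmetricBurkhardt (AlgebraicClosure ℚ) ∩ rationalPoints ℚ (AlgebraicClosure ℚ) 5 0) := by
  exact ⟨isBirationalMorphism_mapToBurkhardt, isSmoothPlaneCurve_genericFibre,
    fun _ _ _ _ _ h => isFlex_cubicForm_rational h,
    symmetricBurkhardt_subset_closure_rationalPoints⟩
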